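/- Corollary 4.3. **Setting.** There are $K\ge 1$ independent streams $X_k=(X_k(n))_{n\ge 1}$, $k\in[K]$. Stream $k$ has law $\mathrm P_k^1$ if it is a signal and $\mathrm P_k^0$ if it is noise; $\mathrm P_A$ is the joint (product) law, and $\mathrm E_A$ the expectation, when $A\subseteq[K]$ is the set of signals. Let $\mathcal F_k(n)=\sigma(X_k(1),\dots,X_k(n))$ and $\mathcal F(n)=\sigma(\mathcal F_k(n),\,k\in[K])$. A sequential multiple testing procedure is $\chi=(T_k,D_k)_{k\in[K]}$, where $T_k\in\{1,2,\dots\}\cup\{\infty\}$ is a stopping time of $(\mathcal F(n))_n$ and $D_k\in\{0,1\}$ is an $\mathcal F(T_k)$-measurable decision ($D_k=1$: stream $k$ is identified as a signal). It is synchronous if $T_1=\dots=T_K$. For integers $0\le l\le u\le K$ with $u>0$ and $l<K$, let $\Pi_{l,u}=\{A\subseteq[K]: l\le|A|\le u\}$. For $\alpha,\beta\in(0,1)$ let $\Delta(\alpha,\beta)$ be the family of procedures such that, for every $A\in\Pi_{l,u}$, $\mathrm P_A(T_k<\infty)=1$ for all $k$, $\mathrm P_A(\exists j\notin A: D_j=1)\le\alpha$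 and $\mathrm P_A(\exists i\in A: D_i=0)\le\beta$. Let $$\mathcal L_{k,A}(\alpha,\beta)=\inf\{\mathrm E_A[T_k]:\chi\in\Delta(\alpha,\beta)\},\qquad \mathcal L''_A(\alpha,\beta)=\inf\{\mathrm E_A[T_1]:\chi\in\Delta(\alpha,\beta),\ \chi\text{ synchronous}\},$$ and let $\mathrm{ARE}''_{k,A}(l,u)$ denote the limit of $\mathcal L_{k,A}(\alpha,\beta)/\mathcal L''_A(\alpha,\beta)$ as $\alpha,\beta\to0$ in the regime considered. **Assumptions.** For every $k$ and $n\ge1$, $\mathrm P_k^0$ and $\mathrm P_k^1$ are mutually absolutely continuous on $\mathcal F_k(n)$, with log-likelihood ratio $\lambda_k(n)=\log\frac{d\mathrm P_k^1}{d\mathrm P_k^0}(\mathcal F_k(n))$. For every $k$ there are numbers $I_k,J_k>0$ with $$\mathrm P_k^1\Big(\limsup_n \tfrac{\lambda_k(n)}n\le I_k\Big)=1,\qquad \mathrm P_k^0\Big(\limsup_n \tfrac{-\lambda_k(n)}n\le J_k\Big)=1,$$ and, for every $\epsilon>0$, $$\sum_{n\ge1}\mathrm P_k^1\Big(\tfrac{\lambda_k(n)}n\le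 I_k-\epsilon\Big)<\infty,\qquad \sum_{n\ge1}\mathrm P_k^0\Big(\tfrac{-\lambda_k(n)}n\le J_k-\epsilon\Big)<\infty.$$ **Conclusion.** Let $A\in\Pi_{l,u}$, $\mathcal I_A=\min_{i\in A}I_i$, $\mathcal J_A=\min_{j\notin A}J_j$, where the minimum over the empty set is $\infty$ (with $\infty\cdot0=0$ and $c/\infty=0$ for $0\le c<\infty$). The limits below exist and satisfy the following. (i) If $\alpha,\beta\to0$ so that $|\log\alpha|/|\log\beta|\to0$, then $$\mathrm{ARE}''_{i,A}(l,u)=0\ \text{ for every } i\in A, \text{ provided that } A\ne[K],\qquad \mathrm{ARE}''_{j,A}(l,u)=\frac{\mathcal J_A+\mathcal I_A\mathbf 1\{|A|=u\}}{J_j+\mathcal I_A\mathbf 1\{|A|=u\}}\ \text{ for every } j\notin A.$$ (ii) If $\alpha,\beta\to0$ so that $|\log\beta|/|\log\alpha|\to0$, then $$\mathrm{ARE}''_{i,A}(l,u)=\frac{\mathcal I_A+\mathcal J_A\mathbf 1\{|A|=l\}}{I_i+\mathcal J_A\mathbf 1\{|A|=l\}}\ \text{ for every } i\in A,\qquad \mathrm{ARE}''_{j,A}(l,u)=0\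 \text{ for every } j\notin A, \text{ provided that } A\ne\emptyset.$$ (iii) If $r>0$ and $\alpha,\beta\to0$ so that $|\log\alpha|/(r|\log\beta|)\to1$, then, with $$M=\max\Big\{\frac{r}{\mathcal I_A+\mathcal J_A\mathbf 1\{|A|=l\}},\ \frac{1}{\mathcal J_A+\mathcal I_A\mathbf 1\{|A|=u\}}\Big\},$$ $$\mathrm{ARE}''_{i,A}(l,u)=\frac{r/(I_i+\mathcal J_A\mathbf 1\{|A|=l\})}{M}\ \text{ for every } i\in A,\qquad \mathrm{ARE}''_{j,A}(l,u)=\frac{1/(J_j+\mathcal I_A\mathbf 1\{|A|=u\})}{M}\ \text{ for every } j\notin A.$$ -/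

import Mathlib

open MeasureTheory Filter Topology
open scoped ENNReal

noncomputable section

namespace SeqMultTest

/-- The sigma-algebra, on the space of paths of one stream, generated by the first `n` observations.
The `t`-th observation (`t = 1, 2, …`) of a path `x` is `x (t - 1)`. -/
@[reducible] def pathSigma (S : Type*) [MeasurableSpace S] (n : ℕ) : MeasurableSpace (ℕ → S) :=
  ⨆ (t : ℕ) (_ : t < n), MeasurableSpace.comap (fun x : ℕ → S => x t) inferInstance

theorem pathSigma_le (S : Type*) [MeasurableSpace S] (n : ℕ) :
    pathSigma S n ≤ (MeasurableSpace.pi : MeasurableSpace (ℕ → S)) :=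
  iSup₂_le fun t _ => (measurable_pi_apply t).comap_le

theorem pathSigma_mono (S : Type*) [MeasurableSpace S] : Monotone (pathSigma S) :=
  fun _ _ hmn => iSup₂_le fun t ht =>
    le_iSup₂_of_le t (lt_of_lt_of_le ht hmn) le_rfl

/-- The space of all observations in all `K` streams. -/
abbrev Obs {K : ℕ} (E : Fin K → Type*) : Type _ := (k : Fin K) → ℕ → E k

/-- The filtration `ℱ(n) = σ(ℱ_k(n), k ∈ [K])` generated by all the streams. -/
def obsFiltration {K : ℕ} (E : Fin K → Type*) [∀ k, MeasurableSpace (E k)] :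
    Filtration ℕ (inferInstance : MeasurableSpace (Obs E)) where
  seq n := ⨆ k : Fin K, MeasurableSpace.comap (fun ω : Obs E => ω k) (pathSigma (E k) n)
  mono' := fun _ _ hmn => iSup_mono fun k => MeasurableSpace.comap_mono (pathSigma_mono (E k) hmn)
  le' := fun n => iSup_le fun k =>
    (MeasurableSpace.comap_mono (pathSigma_le (E k) n)).trans (measurable_pi_apply k).comap_le

/-- A sequential multiple testing procedure: stream `k` is decided at the stopping time `T k`
(a positive, possibly infinite, integer) and identified as a signal iff `D k = true`,
where `D k` is `ℱ(T k)`-measurable. -/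
structure Procedure {K : ℕ} (E : Fin K → Type*) [∀ k, MeasurableSpace (E k)] where
  T : Fin K → Obs E → ℕ∞
  D : Fin K → Obs E → Bool
  one_le_T : ∀ k ω, 1 ≤ T k ω
  isStoppingTime_T : ∀ k, IsStoppingTime (obsFiltration E) (T k)
  measurable_D : ∀ k, Measurable (D k)
  measurableSet_D : ∀ (k : Fin K) (n : ℕ) (b : Bool),
    MeasurableSet[obsFiltration E n] {ω | T k ω = (n : ℕ∞) ∧ D k ω = b}

/-- All the decisions are made at the same time. -/
def Procedure.IsSynchronous {K : ℕ} {E : Fin K → Type*} [∀ k, MeasurableSpace (E k)]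
    (χ : Procedure E) : Prop :=
  ∀ k k' : Fin K, χ.T k = χ.T k'

/-- The joint law `P_A` of the independent streams when the subset of signals is `A`. -/
def jointLaw {K : ℕ} {E : Fin K → Type*} [∀ k, MeasurableSpace (E k)]
    (P0 P1 : (k : Fin K) → Measure (ℕ → E k)) (A : Finset (Fin K)) : Measure (Obs E) :=
  Measure.pi fun k => if k ∈ A then P1 k else P0 k

/-- The class `Π_{l,u}` of the subsets whose size is between `l` and `u`. -/
def sizeClass (K l u : ℕ) : Set (Finset (Fin K)) := {A | l ≤ A.card ∧ A.card ≤ u}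

section Optimal

variable {K : ℕ} {E : Fin K → Type*} [∀ k, MeasurableSpace (E k)]
  (P0 P1 : (k : Fin K) → Measure (ℕ → E k))

/-- Type-I familywise error rate: some noise stream is identified as a signal. -/
def FWE1 (A : Finset (Fin K)) (χ : Procedure E) : ℝ≥0∞ :=
  jointLaw P0 P1 A {ω | ∃ j, j ∉ A ∧ χ.D j ω = true}

/-- Type-II familywise error rate: some signal stream is identified as noise. -/
def FWE2 (A : Finset (Fin K)) (χ : Procedure E) : ℝ≥0∞ :=
  jointLaw P0 P1 A {ω | ∃ i, i ∈ A ∧ χ.D i ω = false}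

/-- The family `Δ(α, β, Π)`: the procedures that, for every subset of signals in the class `C`,
terminate almost surely in every stream and have familywise error rates at most `α` and `β`. -/
def controlled (α β : ℝ) (C : Set (Finset (Fin K))) : Set (Procedure E) :=
  {χ | ∀ A ∈ C, (∀ k, ∀ᵐ ω ∂(jointLaw P0 P1 A), χ.T k ω ≠ ⊤) ∧
    FWE1 P0 P1 A χ ≤ ENNReal.ofReal α ∧ FWE2 P0 P1 A χ ≤ ENNReal.ofReal β}

/-- The expected decision time `E_A[T_k]`. -/
def expTime (A : Finset (Fin K)) (χ : Procedure E) (k : Fin K) : ℝ≥0∞ :=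
  ∫⁻ ω, (χ.T k ω : ℝ≥0∞) ∂(jointLaw P0 P1 A)

/-- `ℒ_{k,A}(α, β, Π)`: the optimal expected decision time in stream `k`. -/
def optTime (k : Fin K) (A : Finset (Fin K)) (α β : ℝ) (C : Set (Finset (Fin K))) : ℝ≥0∞ :=
  ⨅ χ ∈ controlled P0 P1 α β C, expTime P0 P1 A χ k

/-- `ℒ''_A(α, β, Π)`: the optimal expected decision time among synchronous procedures. -/
def optTimeSync [NeZero K] (A : Finset (Fin K)) (α β : ℝ) (C : Set (Finset (Fin K))) : ℝ≥0∞ :=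
  ⨅ χ ∈ controlled P0 P1 α β C ∩ {χ | χ.IsSynchronous}, expTime P0 P1 A χ 0

/-- The relative efficiency of the synchronous family in stream `k`, whose limit is
`ARE''_{k,A}(l, u)`. -/
def relEffSync [NeZero K] (l u : ℕ) (k : Fin K) (A : Finset (Fin K)) (α β : ℝ) : ℝ≥0∞ :=
  optTime P0 P1 k A α β (sizeClass K l u) / optTimeSync P0 P1 A α β (sizeClass K l u)

end Optimal

section Distribution

variable {S : Type*} [MeasurableSpace S]

/-- The restrictions of the two laws to the first `n` observations are mutually absolutely
continuous, for every `n ≥ 1`. -/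
def LocallyEquivalent (Q0 Q1 : Measure (ℕ → S)) : Prop :=
  ∀ n : ℕ, 1 ≤ n →
    Q1.trim (pathSigma_le S n) ≪ Q0.trim (pathSigma_le S n) ∧
    Q0.trim (pathSigma_le S n) ≪ Q1.trim (pathSigma_le S n)

/-- The log-likelihood ratio `λ(n) = log (dQ1 / dQ0)` of the first `n` observations. -/
def logLR (Q0 Q1 : Measure (ℕ → S)) (n : ℕ) : (ℕ → S) → ℝ :=
  llr (Q1.trim (pathSigma_le S n)) (Q0.trim (pathSigma_le S n))

/-- `Q(limsup_n ξ(n)/n ≤ c) = 1`, the upper limit being taken in the extended reals. -/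
def LimsupRateLE {Ω : Type*} [MeasurableSpace Ω] (Q : Measure Ω) (ξ : ℕ → Ω → ℝ) (c : ℝ) : Prop :=
  ∀ᵐ x ∂Q, limsup (fun n : ℕ => ((ξ n x / (n : ℝ) : ℝ) : EReal)) atTop ≤ (c : EReal)

/-- `∑_{n ≥ 1} Q(ξ(n)/n ≤ c - ε) < ∞` for every `ε > 0`. -/
def CompleteRateGE {Ω : Type*} [MeasurableSpace Ω] (Q : Measure Ω) (ξ : ℕ → Ω → ℝ) (c : ℝ) :
    Prop :=
  ∀ ε : ℝ, 0 < ε → ∑' n : ℕ, Q {x | ξ (n + 1) x / ((n + 1 : ℕ) : ℝ) ≤ c - ε} < ∞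

end Distribution

/-- The minimum of `f` over `s`, which is `∞` when `s` is empty. -/
def minOver {K : ℕ} (f : Fin K → ℝ) (s : Finset (Fin K)) : ℝ≥0∞ := ⨅ k ∈ s, ENNReal.ofReal (f k)

/-- `x + 𝒥_A · 1{|A| = l}`, where `𝒥_A` is the minimum of `J` over the noise streams. -/
def signalRate {K : ℕ} (J : Fin K → ℝ) (l : ℕ) (A : Finset (Fin K)) (x : ℝ≥0∞) : ℝ≥0∞ :=
  x + if A.card = l then minOver J Aᶜ else 0

/-- `x + ℐ_A · 1{|A| = u}`, where `ℐ_A` is the minimum of `I` over the signal streams. -/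
def noiseRate {K : ℕ} (I : Fin K → ℝ) (u : ℕ) (A : Finset (Fin K)) (x : ℝ≥0∞) : ℝ≥0∞ :=
  x + if A.card = u then minOver I A else 0

end SeqMultTest

end

/-! For each stream `k`, `optTime` under `P_A` is asymptotic to `|log γ| / R_k`. Here `γ` is `α` if
`k ∈ A` and `β` otherwise. The rate `R_k` (`streamRate`) is the least information rate of `A`
against a subset `B` of the class that disagrees with `A` in `k`. The synchronous optimum is
asymptotic to the maximum over `k` of these quantities, and the corollary is the quotient of the
two.

Lower bound (`eventually_le_optTime`): a correct decision on `k` under `P_A` is an error under such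
a `B`. Stopping early with a log-likelihood ratio below `c` thus has probability at most `exp c`
times an error bound, and before time `N` the ratio is unlikely to exceed its rate times `N`. Only
the `limsup` hypotheses enter here. A synchronous procedure is subject to the bound of every stream
at once.

Upper bound (`eventually_exists_expTime_le`): the infimum is taken at a fixed `A`, so the procedure
may be tailored to `A`. `leadProcedure` stops as soon as `A` beats its alternatives in the streams
of `W k`. Its fallback stops when any subset of the class beats all the others, so that it
terminates under every law of the class. Ville's inequality controls the errors, and complete
convergence bounds the expected delay caused by lagging log-likelihood ratios. Taking `W k = {k}`
attains the rate of stream `k`; taking `W k` to be all streams gives one common stopping time.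

The formula for `R_k` is combinatorial. The cheapest `B` flips stream `k` alone, unless that leaves
the class; then it must also flip a stream of the other kind, at best the one of least rate. -/

namespace SeqMultTest

/-! ### Likelihood ratios between joint laws and Ville's inequality -/

section ChangeOfMeasure

theorem measurable_logLR {S : Type*} [MeasurableSpace S] (Q0 Q1 : Measure (ℕ → S)) (n : ℕ) :
    Measurable[pathSigma S n] (logLR Q0 Q1 n) :=
  measurable_llr _ _

theorem LocallyEquivalent.apply_eq_setLIntegral {S : Type*} [MeasurableSpace S]
    {Q0 Q1 : Measure (ℕ → S)} [IsProbabilityMeasure Q0] [IsProbabilityMeasure Q1]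
    (h : LocallyEquivalent Q0 Q1) {n : ℕ} (hn : 1 ≤ n) {s : Set (ℕ → S)}
    (hs : MeasurableSet[pathSigma S n] s) :
    Q1 s = ∫⁻ x in s, ENNReal.ofReal (Real.exp (logLR Q0 Q1 n x)) ∂Q0 := by
  have hm := pathSigma_le S n
  have hmeas : Measurable[pathSigma S n]
      (fun x => ENNReal.ofReal (Real.exp (logLR Q0 Q1 n x))) := by
    have := measurable_logLR Q0 Q1 n
    fun_prop
  rw [← setLIntegral_trim hm hmeas hs, ← trim_measurableSet_eq hm hs,
    ← Measure.setLIntegral_rnDeriv (h n hn).1 s]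
  refine lintegral_congr_ae (ae_restrict_of_ae ?_)
  filter_upwards [exp_llr_of_ac' _ _ (h n hn).2,
    Measure.rnDeriv_lt_top (Q1.trim hm) (Q0.trim hm)] with x hx hx'
  rw [logLR, hx, ENNReal.ofReal_toReal hx'.ne]

theorem LocallyEquivalent.apply_eq_setLIntegral_neg {S : Type*} [MeasurableSpace S]
    {Q0 Q1 : Measure (ℕ → S)} [IsProbabilityMeasure Q0] [IsProbabilityMeasure Q1]
    (h : LocallyEquivalent Q0 Q1) {n : ℕ} (hn : 1 ≤ n) {s : Set (ℕ → S)}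
    (hs : MeasurableSet[pathSigma S n] s) :
    Q0 s = ∫⁻ x in s, ENNReal.ofReal (Real.exp (-logLR Q0 Q1 n x)) ∂Q1 := by
  have hm := pathSigma_le S n
  have hmeas : Measurable[pathSigma S n]
      (fun x => ENNReal.ofReal (Real.exp (-logLR Q0 Q1 n x))) := by
    have := measurable_logLR Q0 Q1 n
    fun_prop
  rw [← setLIntegral_trim hm hmeas hs, ← trim_measurableSet_eq hm hs,
    ← Measure.setLIntegral_rnDeriv (h n hn).2 s]
  refine lintegral_congr_ae (ae_restrict_of_ae ?_)
  filter_upwards [exp_neg_llr (h n hn).1,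
    Measure.rnDeriv_lt_top (Q0.trim hm) (Q1.trim hm)] with x hx hx'
  rw [logLR, hx, ENNReal.ofReal_toReal hx'.ne]

theorem lintegral_pi_prod_comp {ι : Type*} [Fintype ι] {X : ι → Type*}
    [∀ i, MeasurableSpace (X i)] (μ : ∀ i, Measure (X i)) [∀ i, IsProbabilityMeasure (μ i)]
    {f : ∀ i, X i → ℝ≥0∞} (hf : ∀ i, Measurable (f i)) :
    ∫⁻ x, ∏ i, f i (x i) ∂(Measure.pi μ) = ∏ i, ∫⁻ y, f i y ∂(μ i) := by
  have hind := ProbabilityTheory.iIndepFun_pi (μ := μ) (X := f) (fun i => (hf i).aemeasurable)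
  rw [ProbabilityTheory.lintegral_prod_eq_prod_lintegral_of_indepFun Finset.univ _ hind
    (fun i => (hf i).comp (measurable_pi_apply i))]
  refine Finset.prod_congr rfl fun i _ => ?_
  exact (measurePreserving_eval μ i).lintegral_comp (hf i)

variable {K : ℕ} {E : Fin K → Type*} [∀ k, MeasurableSpace (E k)]
  (P0 P1 : (k : Fin K) → Measure (ℕ → E k))

/-- The log-likelihood ratio of `P_A` against `P_B` based on the first `n` observations. -/
noncomputable def jointLLR (A B : Finset (Fin K)) (n : ℕ) (ω : Obs E) : ℝ :=
  ∑ k, ((if k ∈ A then 1 else 0) - (if k ∈ B then 1 else 0)) * logLR (P0 k) (P1 k) n (ω k)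

theorem obsFiltration_eq_pi (n : ℕ) :
    obsFiltration E n = @MeasurableSpace.pi _ _ fun k => pathSigma (E k) n := rfl

theorem measurable_jointLLR (A B : Finset (Fin K)) (n : ℕ) :
    Measurable[obsFiltration E n] (jointLLR P0 P1 A B n) := by
  refine Finset.measurable_fun_sum _ fun k _ => Measurable.const_mul ?_ _
  refine (measurable_logLR (P0 k) (P1 k) n).comp ?_
  rw [obsFiltration_eq_pi]
  exact @measurable_pi_apply _ _ (fun k => pathSigma (E k) n) k

theorem measurable_jointLLR' (A B : Finset (Fin K)) (n : ℕ) :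
    Measurable (jointLLR P0 P1 A B n) :=
  (measurable_jointLLR P0 P1 A B n).mono ((obsFiltration E).le n) le_rfl

theorem jointLLR_symm (A B : Finset (Fin K)) (n : ℕ) (ω : Obs E) :
    jointLLR P0 P1 B A n ω = -jointLLR P0 P1 A B n ω := by
  simp only [jointLLR, ← Finset.sum_neg_distrib]
  exact Finset.sum_congr rfl fun k _ => by ring

variable [∀ k, IsProbabilityMeasure (P0 k)] [∀ k, IsProbabilityMeasure (P1 k)]

instance isProbabilityMeasure_jointLaw (A : Finset (Fin K)) :
    IsProbabilityMeasure (jointLaw P0 P1 A) := by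
  have (k : Fin K) : IsProbabilityMeasure (if k ∈ A then P1 k else P0 k) := by
    split_ifs <;> infer_instance
  unfold jointLaw
  infer_instance

variable {P0 P1}

/-- By independence the density is the product of the streamwise densities, with factor 1 for
streams on which `A` and `B` agree. -/
theorem jointLaw_eq_setLIntegral (hequiv : ∀ k, LocallyEquivalent (P0 k) (P1 k))
    (A B : Finset (Fin K)) {n : ℕ} (hn : 1 ≤ n) {s : Set (Obs E)}
    (hs : MeasurableSet[obsFiltration E n] s) :
    jointLaw P0 P1 A s =
      ∫⁻ ω in s, ENNReal.ofReal (Real.exp (jointLLR P0 P1 A B n ω)) ∂(jointLaw P0 P1 B) := by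
  have hprob (A : Finset (Fin K)) (k : Fin K) :
      IsProbabilityMeasure (if k ∈ A then P1 k else P0 k) := by
    split_ifs <;> infer_instance
  rw [← withDensity_apply _ ((obsFiltration E).le n _ hs)]
  set c : Fin K → ℝ := fun k => (if k ∈ A then 1 else 0) - (if k ∈ B then 1 else 0) with hc
  have hone (k : Fin K) {t : Set (ℕ → E k)} (ht : MeasurableSet[pathSigma (E k) n] t) :
      (if k ∈ A then P1 k else P0 k) t =
        ∫⁻ x in t, ENNReal.ofReal (Real.exp (c k * logLR (P0 k) (P1 k) n x))
          ∂(if k ∈ B then P1 k else P0 k) := by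
    by_cases hkA : k ∈ A <;> by_cases hkB : k ∈ B
    · simp [hc, hkA, hkB]
    · simpa [hc, hkA, hkB] using (hequiv k).apply_eq_setLIntegral hn ht
    · simpa [hc, hkA, hkB] using (hequiv k).apply_eq_setLIntegral_neg hn ht
    · simp [hc, hkA, hkB]
  -- Rectangles with sides measurable at time `n` form a π-system generating `ℱ(n)`, so the identity
  -- needs checking only on them.
  have hrect : ∀ s ∈ Set.pi Set.univ ''
      Set.pi Set.univ fun k => {t | MeasurableSet[pathSigma (E k) n] t},
      jointLaw P0 P1 A s = (jointLaw P0 P1 B).withDensity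
        (fun ω => ENNReal.ofReal (Real.exp (jointLLR P0 P1 A B n ω))) s := by
    rintro _ ⟨t, ht, rfl⟩
    have ht' (k : Fin K) : MeasurableSet[pathSigma (E k) n] (t k) := ht k trivial
    have htm (k : Fin K) : MeasurableSet (t k) := pathSigma_le _ _ _ (ht' k)
    have hprod (ω : Obs E) : (Set.pi Set.univ t).indicator
        (fun ω => ENNReal.ofReal (Real.exp (jointLLR P0 P1 A B n ω))) ω =
        ∏ k, (t k).indicator
          (fun x => ENNReal.ofReal (Real.exp (c k * logLR (P0 k) (P1 k) n x))) (ω k) := by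
      by_cases h : ω ∈ Set.pi Set.univ t
      · rw [Set.indicator_of_mem h, jointLLR, Real.exp_sum,
          ENNReal.ofReal_prod_of_nonneg fun _ _ => (Real.exp_pos _).le]
        exact Finset.prod_congr rfl fun k _ => by rw [Set.indicator_of_mem (h k trivial)]
      · rw [Set.indicator_of_notMem h]
        simp only [Set.mem_pi, Set.mem_univ, true_imp_iff, not_forall] at h
        obtain ⟨k, hk⟩ := h
        exact (Finset.prod_eq_zero (Finset.mem_univ k) (Set.indicator_of_notMem hk _)).symm
    have hmeas (k : Fin K) : Measurable fun x =>
        ENNReal.ofReal (Real.exp (c k * logLR (P0 k) (P1 k) n x)) := by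
      have := (measurable_logLR (P0 k) (P1 k) n).mono (pathSigma_le _ _) le_rfl
      fun_prop
    rw [withDensity_apply _ (MeasurableSet.univ_pi htm),
      ← lintegral_indicator (MeasurableSet.univ_pi htm)]
    simp_rw [hprod]
    rw [jointLaw, jointLaw, Measure.pi_pi,
      lintegral_pi_prod_comp _ fun k => (hmeas k).indicator (htm k)]
    refine Finset.prod_congr rfl fun k _ => ?_
    rw [hone k (ht' k), lintegral_indicator (htm k)]
  refine ext_on_measurableSpace_of_generate_finite _ _ hrect ((obsFiltration E).le n)
    (@generateFrom_pi _ _ _ fun k => pathSigma (E k) n).symm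
    (@isPiSystem_pi _ _ fun k => pathSigma (E k) n)
    (hrect _ ⟨fun _ => Set.univ, fun k _ => @MeasurableSet.univ _ (pathSigma (E k) n), ?_⟩) hs
  simp

theorem jointLaw_le_exp_mul (hequiv : ∀ k, LocallyEquivalent (P0 k) (P1 k))
    (A B : Finset (Fin K)) {n : ℕ} (hn : 1 ≤ n) {s : Set (Obs E)}
    (hs : MeasurableSet[obsFiltration E n] s) {c : ℝ}
    (hc : ∀ ω ∈ s, jointLLR P0 P1 A B n ω ≤ c) :
    jointLaw P0 P1 A s ≤ ENNReal.ofReal (Real.exp c) * jointLaw P0 P1 B s := by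
  rw [jointLaw_eq_setLIntegral hequiv A B hn hs, ← setLIntegral_const]
  exact setLIntegral_mono' ((obsFiltration E).le n _ hs) fun ω hω =>
    ENNReal.ofReal_le_ofReal (Real.exp_le_exp.2 (hc ω hω))

/-- Ville's inequality. Splitting by the first passage time `n` gives disjoint events of `ℱ(n)`, on
each of which changing measure from `A` to `B` costs at most `exp (-a)`. -/
theorem jointLaw_exists_le_jointLLR (hequiv : ∀ k, LocallyEquivalent (P0 k) (P1 k))
    (A B : Finset (Fin K)) (a : ℝ) :
    jointLaw P0 P1 B {ω | ∃ n, 1 ≤ n ∧ a ≤ jointLLR P0 P1 A B n ω} ≤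
      ENNReal.ofReal (Real.exp (-a)) := by
  set s : ℕ → Set (Obs E) := fun n => {ω | 1 ≤ n ∧ a ≤ jointLLR P0 P1 A B n ω} with hs_def
  have hs (n : ℕ) : MeasurableSet[obsFiltration E n] (s n) :=
    (@MeasurableSet.const _ (obsFiltration E n) (1 ≤ n)).inter
      ((measurable_jointLLR P0 P1 A B n) measurableSet_Ici)
  have hd (n : ℕ) : MeasurableSet[obsFiltration E n] (disjointed s n) := by
    rw [disjointed_eq_inter_compl]
    exact (hs n).inter (MeasurableSet.iInter fun i => MeasurableSet.iInter fun hi =>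
      ((obsFiltration E).mono hi.le _ (hs i)).compl)
  have hU : {ω | ∃ n, 1 ≤ n ∧ a ≤ jointLLR P0 P1 A B n ω} = ⋃ n, disjointed s n := by
    rw [iUnion_disjointed]
    ext ω
    simp [hs_def]
  have hle (n : ℕ) : jointLaw P0 P1 B (disjointed s n) ≤
      ENNReal.ofReal (Real.exp (-a)) * jointLaw P0 P1 A (disjointed s n) := by
    rcases Nat.eq_zero_or_pos n with rfl | hn
    · simp [hs_def]
    · refine jointLaw_le_exp_mul hequiv B A hn (hd n) fun ω hω => ?_
      have := (disjointed_subset s n hω).2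
      rw [jointLLR_symm]
      linarith
  have hdm (n : ℕ) : MeasurableSet (disjointed s n) := (obsFiltration E).le n _ (hd n)
  rw [hU, measure_iUnion (disjoint_disjointed s) hdm]
  calc ∑' n, jointLaw P0 P1 B (disjointed s n)
      ≤ ∑' n, ENNReal.ofReal (Real.exp (-a)) * jointLaw P0 P1 A (disjointed s n) :=
        ENNReal.tsum_le_tsum hle
    _ = ENNReal.ofReal (Real.exp (-a)) * jointLaw P0 P1 A (⋃ n, disjointed s n) := by
        rw [ENNReal.tsum_mul_left, measure_iUnion (disjoint_disjointed s) hdm]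
    _ ≤ ENNReal.ofReal (Real.exp (-a)) := mul_le_of_le_one_right' prob_le_one

end ChangeOfMeasure

/-! ### Growth rates of the joint log-likelihood ratios -/

section Rates

/-- The almost sure rate, under `P_A`, of the log-likelihood ratio of `P_A` against `P_B`. -/
noncomputable def infoRate {K : ℕ} (I J : Fin K → ℝ) (A B : Finset (Fin K)) : ℝ :=
  ∑ k, if k ∈ A then (if k ∈ B then 0 else I k) else (if k ∈ B then J k else 0)

variable {K : ℕ} {E : Fin K → Type*} [∀ k, MeasurableSpace (E k)]

/-- The event that some log-likelihood ratio of `P_A` is behind its rate by `ε` at time `n`. -/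
def lagSet (P0 P1 : (k : Fin K) → Measure (ℕ → E k)) (I J : Fin K → ℝ) (A : Finset (Fin K))
    (ε : ℝ) (n : ℕ) : Set (Obs E) :=
  {ω | ∃ B, jointLLR P0 P1 A B n ω < (infoRate I J A B - ε) * n}

theorem measurableSet_lagSet (P0 P1 : (k : Fin K) → Measure (ℕ → E k)) (I J : Fin K → ℝ)
    (A : Finset (Fin K)) (ε : ℝ) (n : ℕ) :
    MeasurableSet (lagSet P0 P1 I J A ε n) := by
  have : lagSet P0 P1 I J A ε n =
      ⋃ B, {ω | jointLLR P0 P1 A B n ω < (infoRate I J A B - ε) * n} := by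
    ext ω; simp [lagSet]
  rw [this]
  exact MeasurableSet.iUnion fun B =>
    measurableSet_lt (measurable_jointLLR' P0 P1 A B n) measurable_const

variable {P0 P1 : (k : Fin K) → Measure (ℕ → E k)}
  [∀ k, IsProbabilityMeasure (P0 k)] [∀ k, IsProbabilityMeasure (P1 k)]

theorem measurePreserving_eval_jointLaw (A : Finset (Fin K)) (k : Fin K) :
    MeasurePreserving (fun ω : Obs E => ω k) (jointLaw P0 P1 A)
      (if k ∈ A then P1 k else P0 k) := by
  have (k : Fin K) : IsProbabilityMeasure (if k ∈ A then P1 k else P0 k) := by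
    split_ifs <;> infer_instance
  exact measurePreserving_eval (fun k => if k ∈ A then P1 k else P0 k) k

theorem LimsupRateLE.ae_eventually_le {Ω : Type*} [MeasurableSpace Ω] {Q : Measure Ω}
    {ξ : ℕ → Ω → ℝ} {c : ℝ} (h : LimsupRateLE Q ξ c) {δ : ℝ} (hδ : 0 < δ) :
    ∀ᵐ x ∂Q, ∀ᶠ n : ℕ in atTop, ξ n x ≤ (c + δ) * n := by
  filter_upwards [h] with x hx
  have hlt : (c : EReal) < ((c + δ : ℝ) : EReal) := EReal.coe_lt_coe_iff.2 (by linarith)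
  filter_upwards [eventually_lt_of_limsup_lt (hx.trans_lt hlt), eventually_gt_atTop 0] with n hn hn0
  have hn0' : (0 : ℝ) < n := Nat.cast_pos.2 hn0
  exact ((div_lt_iff₀ hn0').1 (EReal.coe_lt_coe_iff.1 hn)).le

theorem ae_eventually_jointLLR_le {I J : Fin K → ℝ}
    (hlim1 : ∀ k, LimsupRateLE (P1 k) (logLR (P0 k) (P1 k)) (I k))
    (hlim0 : ∀ k, LimsupRateLE (P0 k) (fun n x => -logLR (P0 k) (P1 k) n x) (J k))
    (A B : Finset (Fin K)) {ε : ℝ} (hε : 0 < ε) :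
    ∀ᵐ ω ∂(jointLaw P0 P1 A), ∀ᶠ n : ℕ in atTop,
      jointLLR P0 P1 A B n ω ≤ (infoRate I J A B + ε) * n := by
  -- The slack is shared among the streams; `K + 1` keeps the denominator positive even if `K = 0`.
  set δ : ℝ := ε / (K + 1) with hδ_def
  have hδ : 0 < δ := by positivity
  have hKδ : K * δ ≤ ε := by
    rw [hδ_def, mul_div_assoc', div_le_iff₀ (by positivity)]
    nlinarith
  have hone (k : Fin K) : ∀ᵐ ω ∂(jointLaw P0 P1 A), ∀ᶠ n : ℕ in atTop,
      ((if k ∈ A then 1 else 0) - (if k ∈ B then 1 else 0)) * logLR (P0 k) (P1 k) n (ω k) ≤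
        ((if k ∈ A then (if k ∈ B then 0 else I k) else (if k ∈ B then J k else 0)) + δ) * n := by
    have hmp := (measurePreserving_eval_jointLaw (P0 := P0) (P1 := P1) A k).quasiMeasurePreserving
    by_cases hkA : k ∈ A <;> by_cases hkB : k ∈ B
    · simp only [hkA, hkB, if_true, sub_self, zero_mul, zero_add]
      exact ae_of_all _ fun _ => Eventually.of_forall fun n => by positivity
    · simp only [hkA, hkB, if_true, if_false, sub_zero, one_mul] at hmp ⊢
      exact hmp.ae ((hlim1 k).ae_eventually_le hδ)
    · simp only [hkA, hkB, if_true, if_false, zero_sub, neg_mul, one_mul] at hmp ⊢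
      exact hmp.ae ((hlim0 k).ae_eventually_le hδ)
    · simp only [hkA, hkB, if_false, sub_self, zero_mul, zero_add]
      exact ae_of_all _ fun _ => Eventually.of_forall fun n => by positivity
  filter_upwards [ae_all_iff.2 hone] with ω hω
  filter_upwards [eventually_all.2 hω] with n hn
  calc jointLLR P0 P1 A B n ω ≤ ∑ k : Fin K,
        ((if k ∈ A then (if k ∈ B then 0 else I k) else (if k ∈ B then J k else 0)) + δ) * n :=
        Finset.sum_le_sum fun k _ => hn k
    _ = (infoRate I J A B + K * δ) * n := by
        rw [← Finset.sum_mul, Finset.sum_add_distrib]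
        simp [infoRate]
    _ ≤ (infoRate I J A B + ε) * n := by gcongr

/-- If no stream lags by `δ`, the sum over the streams lags by at most `K * δ ≤ ε`. The streamwise
events do not depend on `B`, so all alternatives are handled together. -/
theorem tsum_jointLaw_lagSet_lt_top {I J : Fin K → ℝ}
    (hcomp1 : ∀ k, CompleteRateGE (P1 k) (logLR (P0 k) (P1 k)) (I k))
    (hcomp0 : ∀ k, CompleteRateGE (P0 k) (fun n x => -logLR (P0 k) (P1 k) n x) (J k))
    (A : Finset (Fin K)) {ε : ℝ} (hε : 0 < ε) :
    ∑' n : ℕ, jointLaw P0 P1 A (lagSet P0 P1 I J A ε (n + 1)) < ∞ := by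
  set δ : ℝ := ε / (K + 1) with hδ_def
  have hδ : 0 < δ := by positivity
  have hKδ : K * δ ≤ ε := by
    rw [hδ_def, mul_div_assoc', div_le_iff₀ (by positivity)]
    nlinarith
  set G : Fin K → ℕ → Set (Obs E) := fun k n => {ω |
    (if k ∈ A then logLR (P0 k) (P1 k) (n + 1) (ω k) else -logLR (P0 k) (P1 k) (n + 1) (ω k)) /
      ((n + 1 : ℕ) : ℝ) ≤ (if k ∈ A then I k else J k) - δ} with hG
  have hGsum (k : Fin K) : ∑' n, jointLaw P0 P1 A (G k n) < ∞ := by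
    have hmp := measurePreserving_eval_jointLaw (P0 := P0) (P1 := P1) A k
    have hm (n : ℕ) := (measurable_logLR (P0 k) (P1 k) n).mono (pathSigma_le _ _) le_rfl
    by_cases hkA : k ∈ A
    · simp only [hkA, if_true] at hmp
      convert hcomp1 k δ hδ using 3 with n
      simp only [hG, hkA, if_true]
      refine hmp.measure_preimage
        (s := {x | logLR (P0 k) (P1 k) (n + 1) x / ((n + 1 : ℕ) : ℝ) ≤ I k - δ})
        (MeasurableSet.nullMeasurableSet ?_)
      exact measurableSet_le ((hm _).div_const _) measurable_const
    · simp only [hkA, if_false] at hmp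
      convert hcomp0 k δ hδ using 3 with n
      simp only [hG, hkA, if_false]
      refine hmp.measure_preimage
        (s := {x | -logLR (P0 k) (P1 k) (n + 1) x / ((n + 1 : ℕ) : ℝ) ≤ J k - δ})
        (MeasurableSet.nullMeasurableSet ?_)
      exact measurableSet_le ((hm _).neg.div_const _) measurable_const
  have hsub (n : ℕ) : lagSet P0 P1 I J A ε (n + 1) ⊆ ⋃ k, G k n := by
    rintro ω ⟨B, hB⟩
    by_contra hω
    simp only [Set.mem_iUnion, not_exists] at hω
    refine hB.not_ge ?_
    have hn0 : (0 : ℝ) < ((n + 1 : ℕ) : ℝ) := by positivity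
    calc (infoRate I J A B - ε) * ((n + 1 : ℕ) : ℝ)
        ≤ (infoRate I J A B - K * δ) * ((n + 1 : ℕ) : ℝ) := by gcongr
      _ = ∑ k : Fin K, ((if k ∈ A then (if k ∈ B then 0 else I k)
            else (if k ∈ B then J k else 0)) - δ) * ((n + 1 : ℕ) : ℝ) := by
          rw [← Finset.sum_mul, Finset.sum_sub_distrib]
          simp [infoRate]
      _ ≤ jointLLR P0 P1 A B (n + 1) ω := by
          refine Finset.sum_le_sum fun k _ => ?_
          have hk := hω k
          simp only [hG, Set.mem_ofPred_eq, not_le, lt_div_iff₀ hn0] at hk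
          have := mul_pos hδ hn0
          by_cases hkA : k ∈ A <;> by_cases hkB : k ∈ B <;>
            simp only [hkA, hkB, if_true, if_false] at hk ⊢ <;> nlinarith
  calc ∑' n, jointLaw P0 P1 A (lagSet P0 P1 I J A ε (n + 1))
      ≤ ∑' n, ∑ k, jointLaw P0 P1 A (G k n) :=
        ENNReal.tsum_le_tsum fun n => (measure_mono (hsub n)).trans (measure_iUnion_fintype_le _ _)
    _ = ∑ k, ∑' n, jointLaw P0 P1 A (G k n) :=
        Summable.tsum_finsetSum fun _ _ => ENNReal.summable
    _ < ∞ := ENNReal.sum_lt_top.2 fun k _ => hGsum k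

end Rates

/-! ### Asymptotic lower bound on the expected decision time -/

section LowerBound

variable {K : ℕ} {E : Fin K → Type*} [∀ k, MeasurableSpace (E k)]
  {P0 P1 : (k : Fin K) → Measure (ℕ → E k)}
  [∀ k, IsProbabilityMeasure (P0 k)] [∀ k, IsProbabilityMeasure (P1 k)]

theorem Procedure.measurableSet_T_le (χ : Procedure E) (k : Fin K) (n : ℕ) :
    MeasurableSet {ω | χ.T k ω ≤ (n : ℕ∞)} :=
  (obsFiltration E).le n _ (χ.isStoppingTime_T k n)

/-- Stopping by time `N` happens with decision `!b`, or after the log-likelihood ratio exceeded `c`,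
or with decision `b` and ratio at most `c`. The last event, split by the value of the stopping time,
is transferred to `P_B`. -/
theorem jointLaw_T_le (hequiv : ∀ k, LocallyEquivalent (P0 k) (P1 k))
    (χ : Procedure E) (A B : Finset (Fin K)) (k : Fin K) (b : Bool) (N : ℕ) (c : ℝ) :
    jointLaw P0 P1 A {ω | χ.T k ω ≤ (N : ℕ∞)} ≤
      jointLaw P0 P1 A {ω | χ.D k ω = !b} +
      jointLaw P0 P1 A {ω | ∃ n ≤ N, c < jointLLR P0 P1 A B n ω} +
      ENNReal.ofReal (Real.exp c) * jointLaw P0 P1 B {ω | χ.D k ω = b} := by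
  set s : ℕ → Set (Obs E) := fun n =>
    {ω | χ.T k ω = (n : ℕ∞) ∧ χ.D k ω = b} ∩ {ω | jointLLR P0 P1 A B n ω ≤ c} with hs_def
  have hs (n : ℕ) : MeasurableSet[obsFiltration E n] (s n) :=
    (χ.measurableSet_D k n b).inter ((measurable_jointLLR P0 P1 A B n) measurableSet_Iic)
  have hsub : {ω | χ.T k ω ≤ (N : ℕ∞)} ⊆ {ω | χ.D k ω = !b} ∪
      {ω | ∃ n ≤ N, c < jointLLR P0 P1 A B n ω} ∪ ⋃ n ∈ Finset.Icc 1 N, s n := by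
    intro ω (hω : χ.T k ω ≤ (N : ℕ∞))
    obtain ⟨n, hn⟩ := ENat.ne_top_iff_exists.1 (ne_top_of_le_ne_top (ENat.natCast_ne_top N) hω)
    have hnN : n ≤ N := by rw [← hn] at hω; exact_mod_cast hω
    have hn1 : 1 ≤ n := by have := χ.one_le_T k ω; rw [← hn] at this; exact_mod_cast this
    by_cases hb : χ.D k ω = b
    · by_cases hc : jointLLR P0 P1 A B n ω ≤ c
      · refine Or.inr (Set.mem_biUnion (Finset.mem_coe.2 (Finset.mem_Icc.2 ⟨hn1, hnN⟩)) ?_)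
        exact ⟨⟨hn.symm, hb⟩, hc⟩
      · exact Or.inl (Or.inr ⟨n, hnN, not_le.1 hc⟩)
    · exact Or.inl (Or.inl (Bool.eq_not_of_ne hb))
  have hdisj : Set.PairwiseDisjoint (↑(Finset.Icc 1 N)) s := by
    intro n _ n' _ hne
    refine Set.disjoint_left.2 fun ω hω hω' => hne ?_
    exact_mod_cast hω.1.1.symm.trans hω'.1.1
  have hlast : jointLaw P0 P1 A (⋃ n ∈ Finset.Icc 1 N, s n) ≤
      ENNReal.ofReal (Real.exp c) * jointLaw P0 P1 B {ω | χ.D k ω = b} := by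
    calc jointLaw P0 P1 A (⋃ n ∈ Finset.Icc 1 N, s n)
        ≤ ∑ n ∈ Finset.Icc 1 N, jointLaw P0 P1 A (s n) := measure_biUnion_finset_le _ _
      _ ≤ ∑ n ∈ Finset.Icc 1 N, ENNReal.ofReal (Real.exp c) * jointLaw P0 P1 B (s n) :=
          Finset.sum_le_sum fun n hn => jointLaw_le_exp_mul hequiv A B (Finset.mem_Icc.1 hn).1
            (hs n) fun ω hω => hω.2
      _ = ENNReal.ofReal (Real.exp c) * jointLaw P0 P1 B (⋃ n ∈ Finset.Icc 1 N, s n) := by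
          rw [← Finset.mul_sum, measure_biUnion_finset hdisj
            fun n _ => (obsFiltration E).le n _ (hs n)]
      _ ≤ ENNReal.ofReal (Real.exp c) * jointLaw P0 P1 B {ω | χ.D k ω = b} := by
          gcongr
          exact Set.iUnion₂_subset fun n _ ω hω => hω.1.2
  refine (measure_mono hsub).trans ((measure_union_le _ _).trans ?_)
  gcongr
  exact measure_union_le _ _

/-- Markov's inequality, where an integer time exceeding `N` is at least `N + 1`. -/
theorem le_expTime (χ : Procedure E) (A : Finset (Fin K)) (k : Fin K) (N : ℕ) :
    ((N : ℝ≥0∞) + 1) * (1 - jointLaw P0 P1 A {ω | χ.T k ω ≤ (N : ℕ∞)}) ≤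
      expTime P0 P1 A χ k := by
  have hm := χ.measurableSet_T_le k N
  rw [← prob_compl_eq_one_sub hm, ← setLIntegral_const]
  refine (setLIntegral_mono' hm.compl fun ω hω => ?_).trans (setLIntegral_le_lintegral _ _)
  have h : (N : ℕ∞) < χ.T k ω := not_le.1 hω
  have := Order.add_one_le_of_lt h
  exact_mod_cast ENat.toENNReal_le.2 this

/-- Almost surely the ratio is at most `R * n ≤ R * N` from some random time on, and the finitely
many earlier values are bounded, hence below `R * N` for large `N`. -/
theorem tendsto_jointLaw_exists_lt_jointLLR {I J : Fin K → ℝ}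
    (hlim1 : ∀ k, LimsupRateLE (P1 k) (logLR (P0 k) (P1 k)) (I k))
    (hlim0 : ∀ k, LimsupRateLE (P0 k) (fun n x => -logLR (P0 k) (P1 k) n x) (J k))
    (A B : Finset (Fin K)) {R : ℝ} (hR0 : 0 < R) (hR : infoRate I J A B < R) :
    Tendsto (fun N : ℕ => jointLaw P0 P1 A {ω | ∃ n ≤ N, R * N < jointLLR P0 P1 A B n ω})
      atTop (𝓝 0) := by
  rw [← measure_empty (μ := jointLaw P0 P1 A)]
  refine tendsto_measure_of_ae_tendsto_indicator_of_isFiniteMeasure _ MeasurableSet.empty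
    (fun N => ?_) ?_
  · have : {ω | ∃ n ≤ N, R * N < jointLLR P0 P1 A B n ω} =
        ⋃ n ∈ Finset.range (N + 1), {ω | R * N < jointLLR P0 P1 A B n ω} := by
      ext ω; simp
    rw [this]
    exact Finset.measurableSet_biUnion _ fun n _ =>
      measurableSet_lt measurable_const (measurable_jointLLR' P0 P1 A B n)
  · filter_upwards [ae_eventually_jointLLR_le hlim1 hlim0 A B (sub_pos.2 hR)] with ω hω
    obtain ⟨n₀, hn₀⟩ := eventually_atTop.1 hω
    obtain ⟨M, hM⟩ := ((Finset.range n₀).image fun n => jointLLR P0 P1 A B n ω).bddAbove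
    have hlarge : ∀ᶠ N : ℕ in atTop, M ≤ R * N :=
      (tendsto_natCast_atTop_atTop.const_mul_atTop hR0).eventually_ge_atTop M
    filter_upwards [hlarge] with N hN
    simp only [Set.mem_empty_iff_false, iff_false, not_exists, not_and, not_lt]
    intro n hnN
    rcases lt_or_ge n n₀ with h | h
    · exact (hM (by simpa using ⟨n, h, rfl⟩)).trans hN
    · refine (hn₀ n h).trans ?_
      rw [add_sub_cancel]
      gcongr

theorem eventually_le_optTime (hequiv : ∀ k, LocallyEquivalent (P0 k) (P1 k)) {I J : Fin K → ℝ}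
    (hlim1 : ∀ k, LimsupRateLE (P1 k) (logLR (P0 k) (P1 k)) (I k))
    (hlim0 : ∀ k, LimsupRateLE (P0 k) (fun n x => -logLR (P0 k) (P1 k) n x) (J k))
    {C : Set (Finset (Fin K))} {A B : Finset (Fin K)} (hA : A ∈ C) (hB : B ∈ C) {k : Fin K}
    (hk : k ∈ A ↔ k ∉ B) (hR : 0 < infoRate I J A B)
    {ι : Type*} {F : Filter ι} {α β w : ι → ℝ}
    (hα : Tendsto α F (𝓝[>] 0)) (hβ : Tendsto β F (𝓝[>] 0)) (hw : Tendsto w F atTop) {p m : ℝ}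
    (hp : Tendsto (fun x => -Real.log (if k ∈ A then α x else β x) / w x) F (𝓝 p))
    (hm : m < p / infoRate I J A B) :
    ∀ᶠ x in F, ENNReal.ofReal (m * w x) ≤ optTime P0 P1 k A (α x) (β x) C := by
  rcases le_or_gt m 0 with hm0 | hm0
  · filter_upwards [hw.eventually_ge_atTop 0] with x hx
    rw [ENNReal.ofReal_of_nonpos (mul_nonpos_of_nonpos_of_nonneg hm0 hx)]
    exact zero_le
  -- With `R` the rate, choose `m < m' < p / R` and then `m' * R < c < p`. The horizon is `m' * w`
  -- and the threshold `c * w`: their quotient exceeds `R`, while `exp (c * w)` is negligible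
  -- against `1 / γ`.
  obtain ⟨m', hmm', hm'⟩ := exists_between hm
  have hm'0 : 0 < m' := hm0.trans hmm'
  obtain ⟨c, hc, hcp⟩ := exists_between ((lt_div_iff₀ hR).1 hm')
  have hc0 : 0 < c := (mul_pos hm'0 hR).trans hc
  -- `γ` bounds the probability of the decision `decide (k ∈ A)` under `B`, where it is wrong; `γ'`
  -- bounds that of the opposite decision under `A`.
  set γ : ι → ℝ := fun x => if k ∈ A then α x else β x with hγ_def
  set γ' : ι → ℝ := fun x => if k ∈ A then β x else α x with hγ'_def
  have hγ : Tendsto γ F (𝓝[>] 0) := by by_cases h : k ∈ A <;> simpa [hγ_def, h]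
  have hγ' : Tendsto γ' F (𝓝[>] 0) := by by_cases h : k ∈ A <;> simpa [hγ'_def, h]
  set N : ι → ℕ := fun x => ⌊m' * w x⌋₊ with hN_def
  have hN : Tendsto N F atTop := tendsto_nat_floor_atTop.comp (hw.const_mul_atTop hm'0)
  set V : ℕ → ℝ≥0∞ := fun N =>
    jointLaw P0 P1 A {ω | ∃ n ≤ N, c / m' * N < jointLLR P0 P1 A B n ω} with hV_def
  have hV : Tendsto (fun x => V (N x)) F (𝓝 0) := by
    refine (tendsto_jointLaw_exists_lt_jointLLR hlim1 hlim0 A B (div_pos hc0 hm'0) ?_).comp hN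
    rwa [lt_div_iff₀ hm'0, mul_comm]
  have hexp : Tendsto (fun x => ENNReal.ofReal (Real.exp (c * w x)) * ENNReal.ofReal (γ x)) F
      (𝓝 0) := by
    have h1 : Tendsto (fun x => (c - -Real.log (γ x) / w x) * w x) F atBot :=
      (tendsto_const_nhds.sub hp).neg_mul_atTop (by linarith) hw
    have h2 := ENNReal.tendsto_ofReal (Real.tendsto_exp_atBot.comp h1)
    rw [ENNReal.ofReal_zero] at h2
    refine h2.congr' ?_
    filter_upwards [hw.eventually_gt_atTop 0, hγ self_mem_nhdsWithin] with x hx hγx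
    rw [← ENNReal.ofReal_mul (Real.exp_pos _).le]
    congr 1
    rw [Function.comp_apply, sub_mul, div_mul_cancel₀ _ hx.ne', sub_neg_eq_add, Real.exp_add,
      Real.exp_log hγx]
  have hη : Tendsto (fun x => ENNReal.ofReal (γ' x) + V (N x) +
      ENNReal.ofReal (Real.exp (c * w x)) * ENNReal.ofReal (γ x)) F (𝓝 0) := by
    have h := ENNReal.tendsto_ofReal (hγ'.mono_right nhdsWithin_le_nhds)
    rw [ENNReal.ofReal_zero] at h
    simpa using (h.add hV).add hexp
  have hpos : 0 < ENNReal.ofReal (1 - m / m') :=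
    ENNReal.ofReal_pos.2 (sub_pos.2 ((div_lt_one hm'0).2 hmm'))
  filter_upwards [hη.eventually_le_const hpos, hw.eventually_gt_atTop 0] with x hx hwx
  refine le_iInf₂ fun χ hχ => le_trans ?_ (le_expTime χ A k (N x))
  have hTle : jointLaw P0 P1 A {ω | χ.T k ω ≤ (N x : ℕ∞)} ≤ ENNReal.ofReal (1 - m / m') := by
    refine ((jointLaw_T_le hequiv χ A B k (decide (k ∈ A)) (N x) (c * w x)).trans ?_).trans hx
    refine add_le_add (add_le_add ?_ ?_) (mul_le_mul_right ?_ _)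
    · by_cases h : k ∈ A
      · simp only [h, decide_true, hγ'_def, if_true]
        exact (measure_mono (t := {ω | ∃ i, i ∈ A ∧ χ.D i ω = false})
          fun ω hω => ⟨k, h, hω⟩).trans (hχ A hA).2.2
      · simp only [h, decide_false, hγ'_def, if_false]
        exact (measure_mono (t := {ω | ∃ i, i ∉ A ∧ χ.D i ω = true})
          fun ω hω => ⟨k, h, hω⟩).trans (hχ A hA).2.1
    · refine measure_mono ?_
      rintro ω ⟨n, hn, hlt⟩
      refine ⟨n, hn, lt_of_le_of_lt ?_ hlt⟩
      have hNle : (N x : ℝ) ≤ m' * w x := Nat.floor_le (by positivity)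
      calc c / m' * N x ≤ c / m' * (m' * w x) := by gcongr
        _ = c * w x := by field_simp
    · by_cases h : k ∈ A
      · simp only [h, decide_true, hγ_def, if_true]
        exact (measure_mono (t := {ω | ∃ i, i ∉ B ∧ χ.D i ω = true})
          fun ω hω => ⟨k, hk.1 h, hω⟩).trans (hχ B hB).2.1
      · simp only [h, decide_false, hγ_def, if_false]
        exact (measure_mono (t := {ω | ∃ i, i ∈ B ∧ χ.D i ω = false})
          fun ω hω => ⟨k, not_not.1 (mt hk.2 h), hω⟩).trans (hχ B hB).2.2
  have hsub : ENNReal.ofReal (m / m') ≤ 1 - jointLaw P0 P1 A {ω | χ.T k ω ≤ (N x : ℕ∞)} := by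
    refine le_trans ?_ (tsub_le_tsub_left hTle 1)
    rw [← ENNReal.ofReal_one, ← ENNReal.ofReal_sub _
      (sub_nonneg.2 ((div_le_one hm'0).2 hmm'.le))]
    simp
  calc ENNReal.ofReal (m * w x) = ENNReal.ofReal (m' * w x) * ENNReal.ofReal (m / m') := by
        rw [← ENNReal.ofReal_mul (by positivity)]
        congr 1
        field_simp
    _ ≤ ((N x : ℝ≥0∞) + 1) * (1 - jointLaw P0 P1 A {ω | χ.T k ω ≤ (N x : ℕ∞)}) := by
        gcongr
        refine (ENNReal.ofReal_le_ofReal (Nat.lt_floor_add_one _).le).trans ?_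
        rw [ENNReal.ofReal_add (by positivity) zero_le_one, ENNReal.ofReal_natCast,
          ENNReal.ofReal_one]

end LowerBound

/-! ### First entry times -/

section FirstEntry

/-- The first positive time at which a path is in the sequence of sets `S`. -/
noncomputable def firstEntry {Ω : Type*} (S : ℕ → Set Ω) (ω : Ω) : ℕ∞ :=
  ⨅ (n : ℕ) (_ : 1 ≤ n ∧ ω ∈ S n), (n : ℕ∞)

variable {Ω : Type*} {S : ℕ → Set Ω} {ω : Ω}

theorem one_le_firstEntry : 1 ≤ firstEntry S ω :=
  le_iInf₂ fun _ hn => by exact_mod_cast hn.1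

theorem firstEntry_le {n : ℕ} (hn : 1 ≤ n) (h : ω ∈ S n) : firstEntry S ω ≤ n :=
  iInf₂_le n ⟨hn, h⟩

theorem firstEntry_le_iff {N : ℕ} : firstEntry S ω ≤ N ↔ ∃ n ≤ N, 1 ≤ n ∧ ω ∈ S n := by
  refine ⟨fun h => ?_, fun ⟨n, hnN, hn, hω⟩ => (firstEntry_le hn hω).trans (by exact_mod_cast hnN)⟩
  by_contra! hne
  have : ((N + 1 : ℕ) : ℕ∞) ≤ firstEntry S ω := by
    refine le_iInf₂ fun n hn => ?_
    have hlt : N < n := not_le.1 fun hnN => hne n hnN hn.1 hn.2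
    exact_mod_cast hlt
  have h' : N + 1 ≤ N := by exact_mod_cast this.trans h
  omega

theorem mem_of_firstEntry_eq {n : ℕ} (h : firstEntry S ω = n) : 1 ≤ n ∧ ω ∈ S n := by
  obtain ⟨m, hmn, hm, hω⟩ := firstEntry_le_iff.1 h.le
  have : n ≤ m := by
    have := firstEntry_le hm hω
    rw [h] at this
    exact_mod_cast this
  obtain rfl := le_antisymm hmn this
  exact ⟨hm, hω⟩

theorem measurableSet_firstEntry_le [m : MeasurableSpace Ω] {f : Filtration ℕ m}
    (hS : ∀ n, MeasurableSet[f n] (S n)) (N : ℕ) :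
    MeasurableSet[f N] {ω | firstEntry S ω ≤ N} := by
  have : {ω | firstEntry S ω ≤ N} = ⋃ n ∈ Finset.Icc 1 N, S n := by
    ext ω
    simp only [Set.mem_ofPred_eq, firstEntry_le_iff, Set.mem_iUnion, Finset.mem_Icc, exists_prop]
    exact ⟨fun ⟨n, h, h', h''⟩ => ⟨n, ⟨h', h⟩, h''⟩, fun ⟨n, ⟨h', h⟩, h''⟩ => ⟨n, h, h', h''⟩⟩
  rw [this]
  exact Finset.measurableSet_biUnion _ fun n hn => f.mono (Finset.mem_Icc.1 hn).2 _ (hS n)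

theorem measurableSet_firstEntry_eq [m : MeasurableSpace Ω] {f : Filtration ℕ m}
    (hS : ∀ n, MeasurableSet[f n] (S n)) (N : ℕ) :
    MeasurableSet[f N] {ω | firstEntry S ω = N} :=
  IsStoppingTime.measurableSet_eq (measurableSet_firstEntry_le hS) N

end FirstEntry

/-! ### Procedures built from first entry times -/

section FirstEntryProcedure

variable {K : ℕ} {E : Fin K → Type*} [∀ k, MeasurableSpace (E k)]

open Classical in
/-- The procedure which stops in stream `k` on the first entry into `S k`, and which identifies it
as a signal if the path is in `G k` at that time. -/
noncomputable def firstEntryProcedure (S G : Fin K → ℕ → Set (Obs E))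
    (hS : ∀ k n, MeasurableSet[obsFiltration E n] (S k n))
    (hG : ∀ k n, MeasurableSet[obsFiltration E n] (G k n)) : Procedure E where
  T k := firstEntry (S k)
  -- A path that never enters gets the decision `false`, so false negatives can be analysed only
  -- where the time is finite.
  D k ω := decide (∃ n : ℕ, firstEntry (S k) ω = n ∧ ω ∈ G k n)
  one_le_T _ _ := one_le_firstEntry
  isStoppingTime_T k n := measurableSet_firstEntry_le (hS k) n
  measurable_D k := by
    refine measurable_to_bool ?_
    have : (fun ω => decide (∃ n : ℕ, firstEntry (S k) ω = n ∧ ω ∈ G k n)) ⁻¹' {true} =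
        ⋃ n : ℕ, {ω | firstEntry (S k) ω = n} ∩ G k n := by
      ext ω; simp
    rw [this]
    exact MeasurableSet.iUnion fun n => (obsFiltration E).le n _
      ((measurableSet_firstEntry_eq (hS k) n).inter (hG k n))
  measurableSet_D k n b := by
    have key (ω : Obs E) (h : firstEntry (S k) ω = n) :
        (∃ n' : ℕ, firstEntry (S k) ω = n' ∧ ω ∈ G k n') ↔ ω ∈ G k n := by
      refine ⟨fun ⟨n', hn', hω⟩ => ?_, fun hω => ⟨n, h, hω⟩⟩
      obtain rfl : n = n' := by exact_mod_cast h.symm.trans hn'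
      exact hω
    cases b
    · have : {ω | firstEntry (S k) ω = n ∧
          decide (∃ n' : ℕ, firstEntry (S k) ω = n' ∧ ω ∈ G k n') = false} =
          {ω | firstEntry (S k) ω = n} ∩ (G k n)ᶜ := by
        ext ω
        refine and_congr_right fun h => ?_
        rw [decide_eq_false_iff_not, key ω h]
        rfl
      rw [this]
      exact (measurableSet_firstEntry_eq (hS k) n).inter (hG k n).compl
    · have : {ω | firstEntry (S k) ω = n ∧
          decide (∃ n' : ℕ, firstEntry (S k) ω = n' ∧ ω ∈ G k n') = true} =
          {ω | firstEntry (S k) ω = n} ∩ G k n := by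
        ext ω
        refine and_congr_right fun h => ?_
        rw [decide_eq_true_iff, key ω h]
      rw [this]
      exact (measurableSet_firstEntry_eq (hS k) n).inter (hG k n)

variable {S G : Fin K → ℕ → Set (Obs E)}
  {hS : ∀ k n, MeasurableSet[obsFiltration E n] (S k n)}
  {hG : ∀ k n, MeasurableSet[obsFiltration E n] (G k n)}

theorem firstEntryProcedure_D_eq_true {k : Fin K} {ω : Obs E}
    (h : (firstEntryProcedure S G hS hG).D k ω = true) :
    ∃ n, 1 ≤ n ∧ ω ∈ S k n ∧ ω ∈ G k n := by
  simp only [firstEntryProcedure, decide_eq_true_iff] at h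
  obtain ⟨n, hn, hω⟩ := h
  obtain ⟨h1, h2⟩ := mem_of_firstEntry_eq hn
  exact ⟨n, h1, h2, hω⟩

theorem firstEntryProcedure_D_eq_false {k : Fin K} {ω : Obs E}
    (hT : (firstEntryProcedure S G hS hG).T k ω ≠ ⊤)
    (h : (firstEntryProcedure S G hS hG).D k ω = false) :
    ∃ n, 1 ≤ n ∧ ω ∈ S k n ∧ ω ∉ G k n := by
  obtain ⟨n, hn⟩ := ENat.ne_top_iff_exists.1 hT
  obtain ⟨h1, h2⟩ := mem_of_firstEntry_eq hn.symm
  simp only [firstEntryProcedure, decide_eq_false_iff_not] at h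
  exact ⟨n, h1, h2, fun hω => h ⟨n, hn.symm, hω⟩⟩

end FirstEntryProcedure

/-! ### The procedure tailored to a fixed subset, and its errors -/

section Test

variable {K : ℕ} {E : Fin K → Type*} [∀ k, MeasurableSpace (E k)]
  (P0 P1 : (k : Fin K) → Measure (ℕ → E k))

/-- At time `n`, the subset `A` beats every subset of `C` that differs from it in a stream `m` of
`W`, with threshold `c m`. -/
def leadSet (C : Set (Finset (Fin K))) (A W : Finset (Fin K)) (c : Fin K → ℝ) (n : ℕ) :
    Set (Obs E) :=
  ⋂ m ∈ W, ⋂ B ∈ C, ⋂ (_ : m ∈ A ↔ m ∉ B), {ω | c m ≤ jointLLR P0 P1 A B n ω}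

/-- At time `n`, the subset `A` beats every other subset of `C`, with threshold `a`. -/
def topSet (C : Set (Finset (Fin K))) (A : Finset (Fin K)) (a : ℝ) (n : ℕ) : Set (Obs E) :=
  ⋂ B ∈ C, ⋂ (_ : B ≠ A), {ω | a ≤ jointLLR P0 P1 A B n ω}

theorem measurableSet_leadSet (C : Set (Finset (Fin K))) (A W : Finset (Fin K)) (c : Fin K → ℝ)
    (n : ℕ) : MeasurableSet[obsFiltration E n] (leadSet P0 P1 C A W c n) :=
  MeasurableSet.iInter fun _ => MeasurableSet.iInter fun _ => MeasurableSet.iInter fun B =>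
    MeasurableSet.iInter fun _ => MeasurableSet.iInter fun _ =>
      (measurable_jointLLR P0 P1 A B n) measurableSet_Ici

theorem measurableSet_topSet (C : Set (Finset (Fin K))) (A : Finset (Fin K)) (a : ℝ)
    (n : ℕ) : MeasurableSet[obsFiltration E n] (topSet P0 P1 C A a n) :=
  MeasurableSet.iInter fun B => MeasurableSet.iInter fun _ => MeasurableSet.iInter fun _ =>
    (measurable_jointLLR P0 P1 A B n) measurableSet_Ici

/-- The procedure which stops in stream `k` when either `A` beats its alternatives in the streams of
`W k`, and then decides according to `A`, or some subset of `C` beats all the others. -/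
noncomputable def leadProcedure (C : Set (Finset (Fin K))) (A : Finset (Fin K))
    (W : Fin K → Finset (Fin K)) (c : Fin K → ℝ) (a : ℝ) : Procedure E :=
  firstEntryProcedure
    (fun k n => leadSet P0 P1 C A (W k) c n ∪ ⋃ A' ∈ C, topSet P0 P1 C A' a n)
    (fun k n => (leadSet P0 P1 C A (W k) c n ∩ {_ω | k ∈ A}) ∪
      ((leadSet P0 P1 C A (W k) c n)ᶜ ∩ ⋃ A' ∈ C, ⋃ (_ : k ∈ A'), topSet P0 P1 C A' a n))
    (fun k n => (measurableSet_leadSet P0 P1 C A (W k) c n).union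
      (MeasurableSet.iUnion fun A' => MeasurableSet.iUnion fun _ =>
        measurableSet_topSet P0 P1 C A' a n))
    (fun k n => ((measurableSet_leadSet P0 P1 C A (W k) c n).inter
        (@MeasurableSet.const _ (obsFiltration E n) (k ∈ A))).union
      ((measurableSet_leadSet P0 P1 C A (W k) c n).compl.inter
        (MeasurableSet.iUnion fun A' => MeasurableSet.iUnion fun _ => MeasurableSet.iUnion fun _ =>
          measurableSet_topSet P0 P1 C A' a n)))

variable {P0 P1} {C : Set (Finset (Fin K))} {A : Finset (Fin K)} {W : Fin K → Finset (Fin K)}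
  {c : Fin K → ℝ} {a : ℝ}

theorem leadProcedure_T_congr {k k' : Fin K} (h : W k = W k') :
    (leadProcedure P0 P1 C A W c a).T k = (leadProcedure P0 P1 C A W c a).T k' := by
  simp only [leadProcedure, firstEntryProcedure, h]

theorem leadProcedure_T_le_of_mem_leadSet {k : Fin K} {n : ℕ} (hn : 1 ≤ n) {ω : Obs E}
    (h : ω ∈ leadSet P0 P1 C A (W k) c n) : (leadProcedure P0 P1 C A W c a).T k ω ≤ n :=
  firstEntry_le hn (Or.inl h)

theorem leadProcedure_T_le_of_mem_topSet {k : Fin K} {n : ℕ} (hn : 1 ≤ n) {ω : Obs E}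
    {A' : Finset (Fin K)} (hA' : A' ∈ C) (h : ω ∈ topSet P0 P1 C A' a n) :
    (leadProcedure P0 P1 C A W c a).T k ω ≤ n :=
  firstEntry_le hn (Or.inr (Set.mem_biUnion hA' h))

/-- A wrong decision is inherited from a subset that differs from `B` in `k`. If this is `A`, then
`k ∈ W k` forces it to beat `B` by `c k`; if it comes from the fallback, it beats `B` by `a`. -/
theorem leadProcedure_false_positive (hW : ∀ k, k ∈ W k) {B : Finset (Fin K)} (hB : B ∈ C)
    {k : Fin K} (hk : k ∉ B) {ω : Obs E} (h : (leadProcedure P0 P1 C A W c a).D k ω = true) :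
    (k ∈ A ∧ ∃ n, 1 ≤ n ∧ c k ≤ jointLLR P0 P1 A B n ω) ∨
      ∃ A' : Finset (Fin K), ∃ n, 1 ≤ n ∧ a ≤ jointLLR P0 P1 A' B n ω := by
  obtain ⟨n, hn, -, hG⟩ := firstEntryProcedure_D_eq_true h
  rcases hG with ⟨hlead, hkA : k ∈ A⟩ | ⟨-, htop⟩
  · simp only [leadSet, Set.mem_iInter] at hlead
    exact Or.inl ⟨hkA, n, hn, hlead k (hW k) B hB (iff_of_true hkA hk)⟩
  · simp only [topSet, Set.mem_iUnion, Set.mem_iInter] at htop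
    obtain ⟨A', hA', hkA', htop⟩ := htop
    exact Or.inr ⟨A', n, hn, htop B hB fun h => hk (h ▸ hkA')⟩

theorem leadProcedure_false_negative (hW : ∀ k, k ∈ W k) {B : Finset (Fin K)} (hB : B ∈ C)
    {k : Fin K} (hk : k ∈ B) {ω : Obs E} (hT : (leadProcedure P0 P1 C A W c a).T k ω ≠ ⊤)
    (h : (leadProcedure P0 P1 C A W c a).D k ω = false) :
    (k ∉ A ∧ ∃ n, 1 ≤ n ∧ c k ≤ jointLLR P0 P1 A B n ω) ∨
      ∃ A' : Finset (Fin K), ∃ n, 1 ≤ n ∧ a ≤ jointLLR P0 P1 A' B n ω := by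
  obtain ⟨n, hn, hS, hG⟩ := firstEntryProcedure_D_eq_false hT h
  by_cases hlead : ω ∈ leadSet P0 P1 C A (W k) c n
  · have hkA : k ∉ A := fun hkA => hG (Or.inl ⟨hlead, hkA⟩)
    simp only [leadSet, Set.mem_iInter] at hlead
    exact Or.inl ⟨hkA, n, hn, hlead k (hW k) B hB (iff_of_false hkA (not_not.2 hk))⟩
  · have htop := hS.resolve_left hlead
    simp only [Set.mem_iUnion] at htop
    obtain ⟨A', hA', htop⟩ := htop
    have hkA' : k ∉ A' := fun hkA' => hG (Or.inr ⟨hlead, by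
      simp only [Set.mem_iUnion]; exact ⟨A', hA', hkA', htop⟩⟩)
    simp only [topSet, Set.mem_iInter] at htop
    exact Or.inr ⟨A', n, hn, htop B hB fun h => hkA' (h ▸ hk)⟩

end Test

/-! ### Error control and expected time of the procedure -/

section UpperBound

theorem infoRate_pos {K : ℕ} {I J : Fin K → ℝ} (hI : ∀ k, 0 < I k) (hJ : ∀ k, 0 < J k)
    {A B : Finset (Fin K)} (h : A ≠ B) : 0 < infoRate I J A B := by
  obtain ⟨k, hk⟩ : ∃ k, ¬(k ∈ A ↔ k ∈ B) := by
    by_contra! h'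
    exact h (Finset.ext h')
  refine Finset.sum_pos' (fun k _ => ?_) ⟨k, Finset.mem_univ k, ?_⟩
  · split_ifs <;> first | exact le_rfl | exact (hI k).le | exact (hJ k).le
  · by_cases hkA : k ∈ A <;> by_cases hkB : k ∈ B <;> simp_all

variable {K : ℕ} {E : Fin K → Type*} [∀ k, MeasurableSpace (E k)]
  {P0 P1 : (k : Fin K) → Measure (ℕ → E k)}
  [∀ k, IsProbabilityMeasure (P0 k)] [∀ k, IsProbabilityMeasure (P1 k)]
  {I J : Fin K → ℝ} {C : Set (Finset (Fin K))} {A : Finset (Fin K)} {W : Fin K → Finset (Fin K)}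
  {c : Fin K → ℝ} {a : ℝ}

theorem ae_eventually_le_jointLLR
    (hcomp1 : ∀ k, CompleteRateGE (P1 k) (logLR (P0 k) (P1 k)) (I k))
    (hcomp0 : ∀ k, CompleteRateGE (P0 k) (fun n x => -logLR (P0 k) (P1 k) n x) (J k))
    {A B : Finset (Fin K)} (hR : 0 < infoRate I J A B) (a : ℝ) :
    ∀ᵐ ω ∂(jointLaw P0 P1 A), ∀ᶠ n : ℕ in atTop, a ≤ jointLLR P0 P1 A B (n + 1) ω := by
  filter_upwards [ae_eventually_notMem
    (tsum_jointLaw_lagSet_lt_top hcomp1 hcomp0 A (half_pos hR)).ne] with ω hω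
  have hlarge : ∀ᶠ n : ℕ in atTop, a ≤ infoRate I J A B / 2 * ((n + 1 : ℕ) : ℝ) :=
    ((tendsto_natCast_atTop_atTop.comp (tendsto_add_atTop_nat 1)).const_mul_atTop
      (half_pos hR)).eventually_ge_atTop a
  filter_upwards [hω, hlarge] with n hn hn'
  simp only [lagSet, Set.mem_ofPred_eq, not_exists, not_lt] at hn
  refine hn'.trans (le_trans (le_of_eq ?_) (hn B))
  ring

/-- Under `P_B` the subset `B` itself eventually beats all others, so the fallback stops the
procedure. -/
theorem leadProcedure_ae_ne_top (hI : ∀ k, 0 < I k) (hJ : ∀ k, 0 < J k)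
    (hcomp1 : ∀ k, CompleteRateGE (P1 k) (logLR (P0 k) (P1 k)) (I k))
    (hcomp0 : ∀ k, CompleteRateGE (P0 k) (fun n x => -logLR (P0 k) (P1 k) n x) (J k))
    {B : Finset (Fin K)} (hB : B ∈ C) (k : Fin K) :
    ∀ᵐ ω ∂(jointLaw P0 P1 B), (leadProcedure P0 P1 C A W c a).T k ω ≠ ⊤ := by
  have h (B' : Finset (Fin K)) : ∀ᵐ ω ∂(jointLaw P0 P1 B), ∀ᶠ n : ℕ in atTop,
      B' ≠ B → a ≤ jointLLR P0 P1 B B' (n + 1) ω := by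
    rcases eq_or_ne B' B with rfl | hne
    · simp
    · filter_upwards [ae_eventually_le_jointLLR hcomp1 hcomp0 (infoRate_pos hI hJ hne.symm) a]
        with ω hω
      filter_upwards [hω] with n hn _ using hn
  filter_upwards [ae_all_iff.2 h] with ω hω
  obtain ⟨n, hn⟩ := (eventually_all.2 hω).exists
  refine ne_top_of_le_ne_top (ENat.natCast_ne_top (n + 1))
    (leadProcedure_T_le_of_mem_topSet (Nat.le_add_left 1 n) hB ?_)
  simp only [topSet, Set.mem_iInter]
  exact fun B' _ hne => hn B' hne

theorem jointLaw_union_exists_le (hequiv : ∀ k, LocallyEquivalent (P0 k) (P1 k))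
    (B : Finset (Fin K)) (c a : ℝ) :
    jointLaw P0 P1 B ({ω | ∃ n, 1 ≤ n ∧ c ≤ jointLLR P0 P1 A B n ω} ∪
      ⋃ A', {ω | ∃ n, 1 ≤ n ∧ a ≤ jointLLR P0 P1 A' B n ω}) ≤
      ENNReal.ofReal (Real.exp (-c) + 2 ^ K * Real.exp (-a)) := by
  refine (measure_union_le _ _).trans ?_
  rw [ENNReal.ofReal_add (Real.exp_pos _).le (by positivity)]
  refine add_le_add (jointLaw_exists_le_jointLLR hequiv A B c) ?_
  refine (measure_iUnion_fintype_le _ _).trans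
    ((Finset.sum_le_sum fun A' _ => jointLaw_exists_le_jointLLR hequiv A' B a).trans ?_)
  rw [Finset.sum_const, Finset.card_univ, Fintype.card_finset, Fintype.card_fin, nsmul_eq_mul,
    ENNReal.ofReal_mul (by positivity), ENNReal.ofReal_pow (by norm_num)]
  simp

theorem leadProcedure_mem_controlled (hequiv : ∀ k, LocallyEquivalent (P0 k) (P1 k))
    (hI : ∀ k, 0 < I k) (hJ : ∀ k, 0 < J k)
    (hcomp1 : ∀ k, CompleteRateGE (P1 k) (logLR (P0 k) (P1 k)) (I k))
    (hcomp0 : ∀ k, CompleteRateGE (P0 k) (fun n x => -logLR (P0 k) (P1 k) n x) (J k))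
    (hW : ∀ k, k ∈ W k) {α β cα cβ : ℝ} (hc : ∀ k, c k = if k ∈ A then cα else cβ)
    (hα : Real.exp (-cα) + 2 ^ K * Real.exp (-a) ≤ α)
    (hβ : Real.exp (-cβ) + 2 ^ K * Real.exp (-a) ≤ β) :
    leadProcedure P0 P1 C A W c a ∈ controlled P0 P1 α β C := by
  intro B hB
  have hT := leadProcedure_ae_ne_top (A := A) (W := W) (c := c) (a := a) hI hJ hcomp1 hcomp0 hB
  refine ⟨hT, ?_, ?_⟩
  · refine le_trans (measure_mono ?_) ((jointLaw_union_exists_le (A := A) hequiv B cα a).trans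
      (ENNReal.ofReal_le_ofReal hα))
    rintro ω ⟨k, hk, hω⟩
    rcases leadProcedure_false_positive hW hB hk hω with ⟨hkA, h⟩ | h
    · rw [hc, if_pos hkA] at h
      exact Or.inl h
    · exact Or.inr (Set.mem_iUnion.2 h)
  · refine le_trans (measure_mono_ae ?_) ((jointLaw_union_exists_le (A := A) hequiv B cβ a).trans
      (ENNReal.ofReal_le_ofReal hβ))
    filter_upwards [ae_all_iff.2 hT] with ω hTω
    rintro ⟨k, hk, hω⟩
    rcases leadProcedure_false_negative hW hB hk (hTω k) hω with ⟨hkA, h⟩ | h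
    · rw [hc, if_neg hkA] at h
      exact Or.inl h
    · exact Or.inr (Set.mem_iUnion.2 h)

/-- After the deterministic time `N + 1`, each time passed without stopping is a lag time. The
stopping time is thus at most `N + 1` plus the number of lag times, whose expectation is the series.
-/
theorem expTime_leadProcedure_le (hI : ∀ k, 0 < I k) (hJ : ∀ k, 0 < J k)
    (hcomp1 : ∀ k, CompleteRateGE (P1 k) (logLR (P0 k) (P1 k)) (I k))
    (hcomp0 : ∀ k, CompleteRateGE (P0 k) (fun n x => -logLR (P0 k) (P1 k) n x) (J k))
    (hA : A ∈ C) {ε : ℝ} (k : Fin K) (N : ℕ)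
    (hε : ∀ m ∈ W k, ∀ B ∈ C, (m ∈ A ↔ m ∉ B) → ε ≤ infoRate I J A B)
    (hN : ∀ m ∈ W k, ∀ B ∈ C, (m ∈ A ↔ m ∉ B) →
      c m ≤ (infoRate I J A B - ε) * ((N + 1 : ℕ) : ℝ)) :
    expTime P0 P1 A (leadProcedure P0 P1 C A W c a) k ≤
      ((N + 1 : ℕ) : ℝ≥0∞) + ∑' n : ℕ, jointLaw P0 P1 A (lagSet P0 P1 I J A ε (n + 1)) := by
  set χ := leadProcedure P0 P1 C A W c a with hχ
  have hlag {n : ℕ} (hn : N ≤ n) {ω : Obs E} (h : ((n + 1 : ℕ) : ℕ∞) < χ.T k ω) :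
      ω ∈ lagSet P0 P1 I J A ε (n + 1) := by
    by_contra hω
    simp only [lagSet, Set.mem_ofPred_eq, not_exists, not_lt] at hω
    refine h.not_ge (leadProcedure_T_le_of_mem_leadSet (Nat.le_add_left 1 n) ?_)
    simp only [leadSet, Set.mem_iInter]
    intro m hm B hB hmB
    refine (hN m hm B hB hmB).trans (le_trans ?_ (hω B))
    have := hε m hm B hB hmB
    gcongr
  have hpt : ∀ᵐ ω ∂(jointLaw P0 P1 A), (χ.T k ω : ℝ≥0∞) ≤ ((N + 1 : ℕ) : ℝ≥0∞) +
      ∑' n : ℕ, (lagSet P0 P1 I J A ε (n + 1)).indicator 1 ω := by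
    filter_upwards [leadProcedure_ae_ne_top hI hJ hcomp1 hcomp0 hA k] with ω hω
    obtain ⟨t, ht⟩ := ENat.ne_top_iff_exists.1 hω
    rw [← hχ] at ht
    -- The times `n + 1` with `N ≤ n < t - 1` precede `t`, so all of them are lag times; truncated
    -- subtraction covers `t ≤ N + 1`.
    have hsum : ((t - 1 - N : ℕ) : ℝ≥0∞) ≤
        ∑' n : ℕ, (lagSet P0 P1 I J A ε (n + 1)).indicator 1 ω := by
      refine le_trans (le_of_eq ?_) (ENNReal.sum_le_tsum (Finset.Ico N (t - 1)))
      rw [← Nat.card_Ico, Finset.cast_card]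
      refine Finset.sum_congr rfl fun n hn => ?_
      rw [Finset.mem_Ico] at hn
      rw [Set.indicator_of_mem (hlag hn.1 ?_), Pi.one_apply]
      rw [← ht]
      exact_mod_cast (by omega : n + 1 < t)
    refine le_trans ?_ (add_le_add_right hsum _)
    rw [← ht]
    exact_mod_cast (by omega : t ≤ N + 1 + (t - 1 - N))
  refine (lintegral_mono_ae hpt).trans ?_
  have hm (n : ℕ) : Measurable ((lagSet P0 P1 I J A ε (n + 1)).indicator (1 : Obs E → ℝ≥0∞)) :=
    measurable_one.indicator (measurableSet_lagSet P0 P1 I J A ε (n + 1))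
  rw [lintegral_add_left measurable_const, lintegral_const, measure_univ, mul_one,
    lintegral_tsum fun n => (hm n).aemeasurable]
  simp_rw [lintegral_indicator_one (measurableSet_lagSet P0 P1 I J A ε _)]
  exact le_rfl

end UpperBound

/-! ### Choice of thresholds and the asymptotic upper bound -/

section UpperAsymptotics

variable {K : ℕ} {E : Fin K → Type*} [∀ k, MeasurableSpace (E k)]
  {P0 P1 : (k : Fin K) → Measure (ℕ → E k)}
  [∀ k, IsProbabilityMeasure (P0 k)] [∀ k, IsProbabilityMeasure (P1 k)]
  {I J : Fin K → ℝ} {C : Set (Finset (Fin K))} {A : Finset (Fin K)} {W : Fin K → Finset (Fin K)}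

theorem eventually_exists_expTime_le (hequiv : ∀ k, LocallyEquivalent (P0 k) (P1 k))
    (hI : ∀ k, 0 < I k) (hJ : ∀ k, 0 < J k)
    (hcomp1 : ∀ k, CompleteRateGE (P1 k) (logLR (P0 k) (P1 k)) (I k))
    (hcomp0 : ∀ k, CompleteRateGE (P0 k) (fun n x => -logLR (P0 k) (P1 k) n x) (J k))
    (hA : A ∈ C) (hW : ∀ k, k ∈ W k) {ι : Type*} {F : Filter ι} {α β w : ι → ℝ}
    (hα : Tendsto α F (𝓝[>] 0)) (hβ : Tendsto β F (𝓝[>] 0)) (hw : Tendsto w F atTop)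
    {p : Fin K → ℝ}
    (hp : ∀ k, Tendsto (fun x => -Real.log (if k ∈ A then α x else β x) / w x) F (𝓝 (p k)))
    {k : Fin K} {M m : ℝ} (hM0 : 0 ≤ M)
    (hM : ∀ k' ∈ W k, ∀ B ∈ C, (k' ∈ A ↔ k' ∉ B) → p k' ≤ M * infoRate I J A B) (hm : M < m) :
    ∀ᶠ x in F, ∃ χ ∈ controlled P0 P1 (α x) (β x) C,
      (∀ k₁ k₂, W k₁ = W k₂ → χ.T k₁ = χ.T k₂) ∧
      expTime P0 P1 A χ k ≤ ENNReal.ofReal (m * w x) := by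
  -- The gap `M < m₀` leaves room for the rate loss `ε` and the `log 2` in the thresholds; the gap
  -- `m₀ < m` absorbs the constant `1 + τ`.
  obtain ⟨m₀, hMm₀, hm₀⟩ := exists_between hm
  have hm₀pos : 0 < m₀ := hM0.trans_lt hMm₀
  have hε_ex : ∀ᶠ ε : ℝ in 𝓝[>] 0, 0 < ε ∧ ∀ (k' : Fin K) (B : Finset (Fin K)),
      k' ∈ W k → B ∈ C → (k' ∈ A ↔ k' ∉ B) →
      ε ≤ infoRate I J A B ∧ p k' < (infoRate I J A B - ε) * m₀ := by
    refine (eventually_mem_nhdsWithin (a := (0 : ℝ)) (s := Set.Ioi 0)).and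
      (eventually_all.2 fun k' => eventually_all.2 fun B => ?_)
    by_cases h : k' ∈ W k ∧ B ∈ C ∧ (k' ∈ A ↔ k' ∉ B)
    · have hR : 0 < infoRate I J A B := infoRate_pos hI hJ fun hAB => by
        have := h.2.2; rw [hAB] at this; tauto
      have h1 : ∀ᶠ ε : ℝ in 𝓝 0, ε < infoRate I J A B := eventually_lt_nhds hR
      have h2 : ∀ᶠ ε : ℝ in 𝓝 0, p k' < (infoRate I J A B - ε) * m₀ := by
        have hc : ContinuousAt (fun ε : ℝ => (infoRate I J A B - ε) * m₀) 0 := by fun_prop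
        refine hc.eventually (lt_mem_nhds ?_)
        have := hM k' h.1 B h.2.1 h.2.2
        simp only [sub_zero]
        nlinarith
      filter_upwards [nhdsWithin_le_nhds h1, nhdsWithin_le_nhds h2] with ε h1 h2 _ _ _
      exact ⟨h1.le, h2⟩
    · exact Eventually.of_forall fun ε h₁ h₂ h₃ => absurd ⟨h₁, h₂, h₃⟩ h
  obtain ⟨ε, hε, hεR⟩ := hε_ex.exists
  have htail := tsum_jointLaw_lagSet_lt_top hcomp1 hcomp0 A hε
  set τ := ∑' n : ℕ, jointLaw P0 P1 A (lagSet P0 P1 I J A ε (n + 1)) with hτ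
  have hthr (k' : Fin K) (R : ℝ) (hlt : p k' < R * m₀) : ∀ᶠ x in F,
      -Real.log (if k' ∈ A then α x else β x) + Real.log 2 ≤ R * (m₀ * w x) := by
    have h := (hp k').add (hw.const_div_atTop (Real.log 2))
    rw [add_zero] at h
    filter_upwards [h.eventually_lt_const hlt, hw.eventually_gt_atTop 0] with x hx hwx
    rw [← add_div, div_lt_iff₀ hwx] at hx
    linarith
  have hall : ∀ᶠ x in F, ∀ (k' : Fin K) (B : Finset (Fin K)),
      k' ∈ W k → B ∈ C → (k' ∈ A ↔ k' ∉ B) →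
      -Real.log (if k' ∈ A then α x else β x) + Real.log 2 ≤
        (infoRate I J A B - ε) * (m₀ * w x) := by
    refine eventually_all.2 fun k' => eventually_all.2 fun B => ?_
    by_cases h : k' ∈ W k ∧ B ∈ C ∧ (k' ∈ A ↔ k' ∉ B)
    · filter_upwards [hthr k' _ (hεR k' B h.1 h.2.1 h.2.2).2] with x hx _ _ _ using hx
    · exact Eventually.of_forall fun ε h₁ h₂ h₃ => absurd ⟨h₁, h₂, h₃⟩ h
  filter_upwards [hall, hα self_mem_nhdsWithin, hβ self_mem_nhdsWithin,
    hw.eventually_gt_atTop 0,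
    (hw.const_mul_atTop (sub_pos.2 hm₀)).eventually_ge_atTop (1 + τ.toReal)]
    with x hx (hαx : 0 < α x) (hβx : 0 < β x) hwx hgap
  -- Half of each error budget goes to the decisions made by `A`, half to the union over the `2 ^ K`
  -- possible fallback subsets.
  set a : ℝ := -Real.log (min (α x) (β x)) + Real.log (2 * 2 ^ K) with ha
  have hexp (t s : ℝ) (ht : 0 < t) (hs : 0 < s) :
      Real.exp (-(-Real.log t + Real.log s)) = t / s := by
    rw [neg_add, neg_neg, ← sub_eq_add_neg, Real.exp_sub, Real.exp_log ht, Real.exp_log hs]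
  have hexpa : 2 ^ K * Real.exp (-a) = min (α x) (β x) / 2 := by
    rw [ha, hexp _ _ (lt_min hαx hβx) (by positivity)]
    field_simp
  refine ⟨leadProcedure P0 P1 C A W
    (fun k => -Real.log (if k ∈ A then α x else β x) + Real.log 2) a, ?_,
    fun k₁ k₂ h => leadProcedure_T_congr h, ?_⟩
  · refine leadProcedure_mem_controlled hequiv hI hJ hcomp1 hcomp0 hW
      (cα := -Real.log (α x) + Real.log 2) (cβ := -Real.log (β x) + Real.log 2)
      (fun k => by split_ifs <;> rfl) ?_ ?_
    · rw [hexpa, hexp _ _ hαx two_pos]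
      linarith [min_le_left (α x) (β x)]
    · rw [hexpa, hexp _ _ hβx two_pos]
      linarith [min_le_right (α x) (β x)]
  · refine (expTime_leadProcedure_le hI hJ hcomp1 hcomp0 hA (ε := ε) k ⌊m₀ * w x⌋₊
      (fun k' hk' B hB h => (hεR k' B hk' hB h).1) fun k' hk' B hB h => ?_).trans ?_
    · refine (hx k' B hk' hB h).trans ?_
      have h1 := (hεR k' B hk' hB h).1
      have h2 := (Nat.lt_floor_add_one (m₀ * w x)).le
      push_cast
      exact mul_le_mul_of_nonneg_left h2 (by linarith)
    · rw [← hτ, ← ENNReal.ofReal_toReal htail.ne, ← ENNReal.ofReal_natCast,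
        ← ENNReal.ofReal_add (by positivity) (by positivity)]
      refine ENNReal.ofReal_le_ofReal ?_
      have := Nat.floor_le (mul_pos hm₀pos hwx).le
      push_cast
      nlinarith

end UpperAsymptotics

/-! ### The least information rate over the alternatives -/

section StreamRate

variable {K : ℕ} {I J : Fin K → ℝ}

theorem exists_minOver_eq (f : Fin K → ℝ) {s : Finset (Fin K)} (hs : s.Nonempty) :
    ∃ i ∈ s, minOver f s = ENNReal.ofReal (f i) := by
  obtain ⟨i, hi, hmin⟩ := s.exists_min_image f hs
  exact ⟨i, hi, le_antisymm (iInf₂_le i hi)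
    (le_iInf₂ fun j hj => ENNReal.ofReal_le_ofReal (hmin j hj))⟩

theorem minOver_le (f : Fin K → ℝ) {s : Finset (Fin K)} {i : Fin K} (hi : i ∈ s) :
    minOver f s ≤ ENNReal.ofReal (f i) :=
  iInf₂_le i hi

/-- The signal-noise symmetry, through which the noise streams reduce to the signal streams. -/
theorem infoRate_compl (I J : Fin K → ℝ) (A B : Finset (Fin K)) :
    infoRate J I Aᶜ Bᶜ = infoRate I J A B := by
  refine Finset.sum_congr rfl fun k _ => ?_
  by_cases hkA : k ∈ A <;> by_cases hkB : k ∈ B <;> simp [hkA, hkB]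

theorem noiseRate_eq_signalRate_compl (I : Fin K → ℝ) {u : ℕ} (hu : u ≤ K) (A : Finset (Fin K))
    (x : ℝ≥0∞) : noiseRate I u A x = signalRate I (K - u) Aᶜ x := by
  have hcard : A.card ≤ K := by simpa using A.card_le_univ
  have : Aᶜ.card = K - u ↔ A.card = u := by
    rw [Finset.card_compl, Fintype.card_fin]; omega
  simp [noiseRate, signalRate, this]

theorem compl_mem_sizeClass {l u : ℕ} {A : Finset (Fin K)} (hA : A ∈ sizeClass K l u) :
    Aᶜ ∈ sizeClass K (K - u) (K - l) := by
  have hA' : l ≤ A.card ∧ A.card ≤ u := hA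
  change K - u ≤ Aᶜ.card ∧ Aᶜ.card ≤ K - l
  rw [Finset.card_compl, Fintype.card_fin]
  omega

/-- A subset `B` missing `i` already pays `I i`. If `A` has the minimal size `l`, then `B` cannot be
a proper subset of `A`, so it also pays `J j` for some `j ∉ A`. -/
theorem signalRate_le_infoRate (hI : ∀ k, 0 < I k) (hJ : ∀ k, 0 < J k) {l u : ℕ}
    {A B : Finset (Fin K)} (hB : B ∈ sizeClass K l u) {i : Fin K} (hiA : i ∈ A) (hiB : i ∉ B) :
    signalRate J l A (ENNReal.ofReal (I i)) ≤ ENNReal.ofReal (infoRate I J A B) := by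
  set f : Fin K → ℝ := fun k =>
    if k ∈ A then (if k ∈ B then 0 else I k) else (if k ∈ B then J k else 0) with hf
  have hf0 (k : Fin K) : 0 ≤ f k := by
    simp only [hf]
    split_ifs <;> first | exact le_rfl | exact (hI k).le | exact (hJ k).le
  have hfi : f i = I i := by simp [hf, hiA, hiB]
  unfold signalRate
  split_ifs with hcard
  · obtain ⟨j, hjB, hjA⟩ : ∃ j ∈ B, j ∉ A := by
      by_contra! hsub
      have hss : B ⊂ A := ⟨hsub, fun h => hiB (h hiA)⟩
      have := Finset.card_lt_card hss
      have hB' : l ≤ B.card := hB.1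
      omega
    have hij : i ≠ j := fun h => hjA (h ▸ hiA)
    have hfj : f j = J j := by simp [hf, hjA, hjB]
    calc ENNReal.ofReal (I i) + minOver J Aᶜ
        ≤ ENNReal.ofReal (I i) + ENNReal.ofReal (J j) := by
          gcongr
          exact minOver_le J (Finset.mem_compl.2 hjA)
      _ = ENNReal.ofReal (∑ k ∈ {i, j}, f k) := by
          rw [Finset.sum_pair hij, hfi, hfj, ENNReal.ofReal_add (hI i).le (hJ j).le]
      _ ≤ ENNReal.ofReal (infoRate I J A B) := ENNReal.ofReal_le_ofReal
          (Finset.sum_le_sum_of_subset_of_nonneg (Finset.subset_univ _) fun k _ _ => hf0 k)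
  · rw [add_zero, ← hfi]
    exact ENNReal.ofReal_le_ofReal
      (Finset.single_le_sum (f := f) (fun k _ => hf0 k) (Finset.mem_univ i))

theorem exists_signalRate_eq_infoRate (hI : ∀ k, 0 < I k) (hJ : ∀ k, 0 < J k) {l u : ℕ}
    (hl : l < K) {A : Finset (Fin K)} (hA : A ∈ sizeClass K l u) {i : Fin K} (hiA : i ∈ A) :
    ∃ B ∈ sizeClass K l u, i ∉ B ∧
      signalRate J l A (ENNReal.ofReal (I i)) = ENNReal.ofReal (infoRate I J A B) := by
  have hA' : l ≤ A.card ∧ A.card ≤ u := hA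
  have hpos : 0 < A.card := Finset.card_pos.2 ⟨i, hiA⟩
  by_cases hcard : A.card = l
  · have hne : Aᶜ.Nonempty := by
      rw [← Finset.card_pos, Finset.card_compl, Fintype.card_fin]
      omega
    obtain ⟨j, hj, hjmin⟩ := exists_minOver_eq J hne
    have hjA := Finset.mem_compl.1 hj
    have hij : i ≠ j := fun h => hjA (h ▸ hiA)
    -- At minimal size, `i` is swapped with the noise stream of least `J`; a noise stream exists
    -- because `l < K`.
    refine ⟨insert j (A.erase i), ?_, by simp [hij], ?_⟩
    · have : (insert j (A.erase i)).card = A.card := by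
        rw [Finset.card_insert_of_notMem (by simp [hjA]), Finset.card_erase_of_mem hiA]
        omega
      change l ≤ _ ∧ _ ≤ u
      rwa [this]
    · rw [signalRate, if_pos hcard, hjmin, ← ENNReal.ofReal_add (hI i).le (hJ j).le, infoRate,
        Finset.sum_eq_add i j hij (fun k _ hk => ?_) (by simp) (by simp)]
      · simp [hiA, hij, hjA]
      · by_cases hkA : k ∈ A <;> simp [hkA, hk.1, hk.2]
  · refine ⟨A.erase i, ?_, by simp, ?_⟩
    · change l ≤ _ ∧ _ ≤ u
      rw [Finset.card_erase_of_mem hiA]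
      omega
    · rw [signalRate, if_neg hcard, add_zero, infoRate,
        Finset.sum_eq_single i (fun k _ hk => ?_) (by simp)]
      · simp [hiA]
      · by_cases hkA : k ∈ A <;> simp [hkA, hk]

/-- The information rate that governs the decision time in stream `k` under `P_A`. -/
noncomputable def streamRate (I J : Fin K → ℝ) (l u : ℕ) (A : Finset (Fin K)) (k : Fin K) :
    ℝ≥0∞ :=
  if k ∈ A then signalRate J l A (ENNReal.ofReal (I k))
  else noiseRate I u A (ENNReal.ofReal (J k))

variable {l u : ℕ} {A : Finset (Fin K)}

theorem streamRate_le_infoRate (hI : ∀ k, 0 < I k) (hJ : ∀ k, 0 < J k) (huK : u ≤ K)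
    {B : Finset (Fin K)} (hB : B ∈ sizeClass K l u) {k : Fin K} (hk : k ∈ A ↔ k ∉ B) :
    streamRate I J l u A k ≤ ENNReal.ofReal (infoRate I J A B) := by
  unfold streamRate
  split_ifs with hkA
  · exact signalRate_le_infoRate hI hJ hB hkA (hk.1 hkA)
  · have hkB : k ∈ B := not_not.1 (mt hk.2 hkA)
    rw [noiseRate_eq_signalRate_compl I huK, ← infoRate_compl]
    exact signalRate_le_infoRate hJ hI (compl_mem_sizeClass hB) (by simpa) (by simpa)

theorem exists_streamRate_eq_infoRate (hI : ∀ k, 0 < I k) (hJ : ∀ k, 0 < J k)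
    (huK : u ≤ K) (hu : 0 < u) (hl : l < K) (hA : A ∈ sizeClass K l u) (k : Fin K) :
    ∃ B ∈ sizeClass K l u, (k ∈ A ↔ k ∉ B) ∧
      streamRate I J l u A k = ENNReal.ofReal (infoRate I J A B) := by
  unfold streamRate
  split_ifs with hkA
  · obtain ⟨B, hB, hkB, h⟩ := exists_signalRate_eq_infoRate hI hJ hl hA hkA
    exact ⟨B, hB, iff_of_true hkA hkB, h⟩
  · obtain ⟨B, hB, hkB, h⟩ := exists_signalRate_eq_infoRate hJ hI (by omega : K - u < K)
      (compl_mem_sizeClass hA) (Finset.mem_compl.2 hkA)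
    refine ⟨Bᶜ, ?_, iff_of_false hkA (by simpa using hkB), ?_⟩
    · have := compl_mem_sizeClass hB
      rwa [Nat.sub_sub_self huK, Nat.sub_sub_self hl.le] at this
    · rw [noiseRate_eq_signalRate_compl I huK, h, ← infoRate_compl I J, compl_compl]

end StreamRate

/-! ### Limits of the optimal times and of their quotient -/

section Limits

variable {K : ℕ} {I J : Fin K → ℝ} {l u : ℕ} {A : Finset (Fin K)}

theorem tendsto_div_ofReal {ι : Type*} {F : Filter ι} {f : ι → ℝ≥0∞} {w : ι → ℝ}
    (hw : Tendsto w F atTop) {M : ℝ}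
    (hlow : ∀ m < M, ∀ᶠ x in F, ENNReal.ofReal (m * w x) ≤ f x)
    (hup : ∀ m, M < m → ∀ᶠ x in F, f x ≤ ENNReal.ofReal (m * w x)) :
    Tendsto (fun x => f x / ENNReal.ofReal (w x)) F (𝓝 (ENNReal.ofReal M)) := by
  refine tendsto_order.2 ⟨fun a ha => ?_, fun a ha => ?_⟩
  · obtain ⟨m, hm0, ham, hmM⟩ := ENNReal.lt_iff_exists_real_btwn.1 ha
    have hmM' : m < M := (ENNReal.ofReal_lt_ofReal_iff_of_nonneg hm0).1 hmM
    filter_upwards [hlow m hmM', hw.eventually_gt_atTop 0] with x hx hwx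
    refine ham.trans_le ?_
    rwa [ENNReal.le_div_iff_mul_le (Or.inl (ENNReal.ofReal_pos.2 hwx).ne')
      (Or.inl ENNReal.ofReal_ne_top), ← ENNReal.ofReal_mul hm0]
  · obtain ⟨m, hm0, hMm, hma⟩ := ENNReal.lt_iff_exists_real_btwn.1 ha
    have hMm' : M < m := (ENNReal.ofReal_lt_ofReal_iff'.1 hMm).1
    filter_upwards [hup m hMm', hw.eventually_gt_atTop 0] with x hx hwx
    refine lt_of_le_of_lt ?_ hma
    rwa [ENNReal.div_le_iff (ENNReal.ofReal_pos.2 hwx).ne' ENNReal.ofReal_ne_top,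
      ← ENNReal.ofReal_mul hm0]

theorem signalRate_mono (J : Fin K → ℝ) (l : ℕ) (A : Finset (Fin K)) {x y : ℝ≥0∞} (h : x ≤ y) :
    signalRate J l A x ≤ signalRate J l A y :=
  add_le_add_left h _

theorem noiseRate_mono (I : Fin K → ℝ) (u : ℕ) (A : Finset (Fin K)) {x y : ℝ≥0∞} (h : x ≤ y) :
    noiseRate I u A x ≤ noiseRate I u A y :=
  add_le_add_left h _

/-- The limit of the normalised optimal decision time among synchronous procedures, when
`|log α|` and `|log β|` are asymptotic to `p` and `q` times the normalisation. -/
noncomputable def syncLimit (I J : Fin K → ℝ) (l u : ℕ) (A : Finset (Fin K)) (p q : ℝ) : ℝ≥0∞ :=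
  max (ENNReal.ofReal p / signalRate J l A (minOver I A))
    (ENNReal.ofReal q / noiseRate I u A (minOver J Aᶜ))

theorem div_streamRate_le_syncLimit (I J : Fin K → ℝ) (l u : ℕ) (A : Finset (Fin K)) (p q : ℝ)
    (k : Fin K) :
    ENNReal.ofReal (if k ∈ A then p else q) / streamRate I J l u A k ≤
      syncLimit I J l u A p q := by
  by_cases hk : k ∈ A
  · simp only [streamRate, hk, if_true]
    refine le_trans ?_ (le_max_left _ _)
    gcongr
    exact signalRate_mono J l A (minOver_le I hk)
  · simp only [streamRate, hk, if_false]
    refine le_trans ?_ (le_max_right _ _)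
    gcongr
    exact noiseRate_mono I u A (minOver_le J (Finset.mem_compl.2 hk))

/-- The minimum inside the larger term is attained at a stream. If `A` or `Aᶜ` is empty, its term is
a division by `∞`, hence `0`, and cannot be a nonzero maximum. -/
theorem exists_syncLimit_eq {p q : ℝ} (h : syncLimit I J l u A p q ≠ 0) :
    ∃ k, syncLimit I J l u A p q =
      ENNReal.ofReal (if k ∈ A then p else q) / streamRate I J l u A k := by
  unfold syncLimit at h ⊢
  rcases max_choice (ENNReal.ofReal p / signalRate J l A (minOver I A))
    (ENNReal.ofReal q / noiseRate I u A (minOver J Aᶜ)) with hmax | hmax <;> rw [hmax] at h ⊢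
  · rcases A.eq_empty_or_nonempty with rfl | hA
    · simp [minOver, signalRate] at h
    · obtain ⟨i, hi, hmin⟩ := exists_minOver_eq I hA
      exact ⟨i, by simp [streamRate, hi, hmin]⟩
  · rcases Aᶜ.eq_empty_or_nonempty with hA | hA
    · simp [minOver, noiseRate, hA] at h
    · obtain ⟨j, hj, hmin⟩ := exists_minOver_eq J hA
      exact ⟨j, by simp [streamRate, Finset.mem_compl.1 hj, hmin]⟩

variable [NeZero K] {E : Fin K → Type*} [∀ k, MeasurableSpace (E k)]
  {P0 P1 : (k : Fin K) → Measure (ℕ → E k)}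

theorem optTime_le_optTimeSync (k : Fin K) (A : Finset (Fin K)) (α β : ℝ)
    (C : Set (Finset (Fin K))) : optTime P0 P1 k A α β C ≤ optTimeSync P0 P1 A α β C := by
  refine le_iInf₂ fun χ hχ => ?_
  have : expTime P0 P1 A χ 0 = expTime P0 P1 A χ k := by
    simp only [expTime, hχ.2 0 k]
  rw [this]
  exact iInf₂_le χ hχ.1

variable [∀ k, IsProbabilityMeasure (P0 k)] [∀ k, IsProbabilityMeasure (P1 k)]

theorem tendsto_relEffSync (hI : ∀ k, 0 < I k) (hJ : ∀ k, 0 < J k)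
    (hequiv : ∀ k, LocallyEquivalent (P0 k) (P1 k))
    (hlim1 : ∀ k, LimsupRateLE (P1 k) (logLR (P0 k) (P1 k)) (I k))
    (hlim0 : ∀ k, LimsupRateLE (P0 k) (fun n x => -logLR (P0 k) (P1 k) n x) (J k))
    (hcomp1 : ∀ k, CompleteRateGE (P1 k) (logLR (P0 k) (P1 k)) (I k))
    (hcomp0 : ∀ k, CompleteRateGE (P0 k) (fun n x => -logLR (P0 k) (P1 k) n x) (J k))
    (huK : u ≤ K) (hu : 0 < u) (hl : l < K) (hA : A ∈ sizeClass K l u)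
    {ι : Type*} {F : Filter ι} {α β w : ι → ℝ}
    (hα : Tendsto α F (𝓝[>] 0)) (hβ : Tendsto β F (𝓝[>] 0)) (hw : Tendsto w F atTop)
    {p q : ℝ} (hp0 : 0 ≤ p) (hq0 : 0 ≤ q)
    (hp : Tendsto (fun x => -Real.log (α x) / w x) F (𝓝 p))
    (hq : Tendsto (fun x => -Real.log (β x) / w x) F (𝓝 q))
    (hpq : ∃ k, 0 < if k ∈ A then p else q) (k : Fin K) :
    Tendsto (fun x => relEffSync P0 P1 l u k A (α x) (β x)) F
      (𝓝 (ENNReal.ofReal (if k ∈ A then p else q) / streamRate I J l u A k /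
        syncLimit I J l u A p q)) := by
  set r : Fin K → ℝ := fun k => if k ∈ A then p else q with hr
  have hr0 (k : Fin K) : 0 ≤ r k := by simp only [hr]; split_ifs <;> assumption
  have hrlim (k : Fin K) :
      Tendsto (fun x => -Real.log (if k ∈ A then α x else β x) / w x) F (𝓝 (r k)) := by
    by_cases hk : k ∈ A <;> simpa [hr, hk]
  choose B hB hsep hrate using fun k => exists_streamRate_eq_infoRate (k := k) hI hJ huK hu hl hA
  have hRpos (k : Fin K) : 0 < infoRate I J A (B k) := infoRate_pos hI hJ fun h => by
    have := hsep k; rw [← h] at this; tauto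
  set v : Fin K → ℝ := fun k => r k / infoRate I J A (B k) with hv
  have hv0 (k : Fin K) : 0 ≤ v k := div_nonneg (hr0 k) (hRpos k).le
  have hv_eq (k : Fin K) : ENNReal.ofReal (r k) / streamRate I J l u A k = ENNReal.ofReal (v k) := by
    rw [hrate, ENNReal.ofReal_div_of_pos (hRpos k)]
  have hlow (k : Fin K) (m : ℝ) (hm : m < v k) :
      ∀ᶠ x in F, ENNReal.ofReal (m * w x) ≤
        optTime P0 P1 k A (α x) (β x) (sizeClass K l u) :=
    eventually_le_optTime hequiv hlim1 hlim0 hA (hB k) (hsep k) (hRpos k) hα hβ hw (hrlim k) hm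
  have hbound (k : Fin K) (B' : Finset (Fin K)) (hB' : B' ∈ sizeClass K l u)
      (hk : k ∈ A ↔ k ∉ B') : r k ≤ v k * infoRate I J A B' := by
    have hle := streamRate_le_infoRate hI hJ huK hB' hk
    have hpos : 0 < infoRate I J A B' := infoRate_pos hI hJ fun h => by rw [← h] at hk; tauto
    rw [hrate, ENNReal.ofReal_le_ofReal_iff hpos.le] at hle
    calc r k = v k * infoRate I J A (B k) := (div_mul_cancel₀ _ (hRpos k).ne').symm
      _ ≤ v k * infoRate I J A B' := mul_le_mul_of_nonneg_left hle (hv0 k)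
  have hopt : Tendsto (fun x => optTime P0 P1 k A (α x) (β x) (sizeClass K l u) /
      ENNReal.ofReal (w x)) F (𝓝 (ENNReal.ofReal (v k))) := by
    refine tendsto_div_ofReal hw (hlow k) fun m hm => ?_
    filter_upwards [eventually_exists_expTime_le (W := fun k => {k}) hequiv hI hJ hcomp1 hcomp0 hA
      (fun k => Finset.mem_singleton_self k) hα hβ hw hrlim (k := k) (hv0 k)
      (fun k' hk' B' hB' h => by
        obtain rfl := Finset.mem_singleton.1 hk'
        exact hbound k' B' hB' h) hm] with x ⟨χ, hχ, _, hle⟩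
    exact (iInf₂_le χ hχ).trans hle
  have hM0 : syncLimit I J l u A p q ≠ 0 := by
    obtain ⟨k₁, hk₁⟩ := hpq
    refine (lt_of_lt_of_le ?_ (div_streamRate_le_syncLimit I J l u A p q k₁)).ne'
    refine lt_of_lt_of_eq (ENNReal.ofReal_pos.2 ?_) (hv_eq k₁).symm
    exact div_pos hk₁ (hRpos k₁)
  -- `κ` is the bottleneck stream: its lower bound passes to synchronous procedures, and its `v κ`
  -- dominates every `v k`, as the upper bound with `W = Finset.univ` requires.
  obtain ⟨κ, hκ⟩ := exists_syncLimit_eq hM0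
  have hκ' : syncLimit I J l u A p q = ENNReal.ofReal (v κ) := hκ.trans (hv_eq κ)
  have hvκ (k : Fin K) : v k ≤ v κ := by
    have := div_streamRate_le_syncLimit I J l u A p q k
    rw [hκ'] at this
    exact (ENNReal.ofReal_le_ofReal_iff (hv0 κ)).1 ((hv_eq k).symm.le.trans this)
  have hsync : Tendsto (fun x => optTimeSync P0 P1 A (α x) (β x) (sizeClass K l u) /
      ENNReal.ofReal (w x)) F (𝓝 (ENNReal.ofReal (v κ))) := by
    refine tendsto_div_ofReal hw (fun m hm => ?_) fun m hm => ?_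
    · filter_upwards [hlow κ m hm] with x hx
      exact hx.trans (optTime_le_optTimeSync κ A _ _ _)
    · filter_upwards [eventually_exists_expTime_le (W := fun _ => Finset.univ) hequiv hI hJ hcomp1
        hcomp0 hA (fun k => Finset.mem_univ k) hα hβ hw hrlim (k := 0) (hv0 κ)
        (fun k' _ B' hB' h => (hbound k' B' hB' h).trans (mul_le_mul_of_nonneg_right (hvκ k')
          (infoRate_pos hI hJ fun h' => by rw [← h'] at h; tauto).le)) hm]
        with x ⟨χ, hχ, hT, hle⟩
      exact (iInf₂_le χ ⟨hχ, fun k k' => hT k k' rfl⟩).trans hle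
  rw [hκ']
  change Tendsto _ _ (𝓝 (ENNReal.ofReal (r k) / _ / _))
  rw [hv_eq]
  refine (ENNReal.Tendsto.div hopt (Or.inr (hκ' ▸ hM0)) hsync
    (Or.inl ENNReal.ofReal_ne_top)).congr' ?_
  filter_upwards [hw.eventually_gt_atTop 0] with x hx
  have h0 := (ENNReal.ofReal_pos.2 hx).ne'
  rw [relEffSync, div_eq_mul_inv _ (ENNReal.ofReal (w x)),
    div_eq_mul_inv _ (ENNReal.ofReal (w x)), ENNReal.mul_div_mul_right _ _
      (ENNReal.inv_ne_zero.2 ENNReal.ofReal_ne_top) (ENNReal.inv_ne_top.2 h0)]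

theorem ennreal_inv_div_inv (x y : ℝ≥0∞) : x⁻¹ / y⁻¹ = y / x := by
  rw [div_eq_mul_inv, inv_inv, mul_comm, div_eq_mul_inv]

end Limits

end SeqMultTest

/-! ### The three asymptotic regimes -/

theorem corollary4p3 {K : ℕ} [NeZero K] {E : Fin K → Type*} [∀ k, MeasurableSpace (E k)]
    (P0 P1 : (k : Fin K) → Measure (ℕ → E k))
    [∀ k, IsProbabilityMeasure (P0 k)] [∀ k, IsProbabilityMeasure (P1 k)]
    (I J : Fin K → ℝ) (hI : ∀ k, 0 < I k) (hJ : ∀ k, 0 < J k)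
    (hequiv : ∀ k, SeqMultTest.LocallyEquivalent (P0 k) (P1 k))
    (hlim1 : ∀ k, SeqMultTest.LimsupRateLE (P1 k)
      (SeqMultTest.logLR (P0 k) (P1 k)) (I k))
    (hlim0 : ∀ k, SeqMultTest.LimsupRateLE (P0 k)
      (fun n x => -SeqMultTest.logLR (P0 k) (P1 k) n x) (J k))
    (hcomp1 : ∀ k, SeqMultTest.CompleteRateGE (P1 k)
      (SeqMultTest.logLR (P0 k) (P1 k)) (I k))
    (hcomp0 : ∀ k, SeqMultTest.CompleteRateGE (P0 k)
      (fun n x => -SeqMultTest.logLR (P0 k) (P1 k) n x) (J k))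
    (l u : ℕ) (hlu : l ≤ u) (huK : u ≤ K) (hu : 0 < u) (hl : l < K)
    (A : Finset (Fin K)) (hA : A ∈ SeqMultTest.sizeClass K l u)
    {ι : Type*} (F : Filter ι) (α β : ι → ℝ)
    (hα : Tendsto α F (𝓝[>] 0)) (hβ : Tendsto β F (𝓝[>] 0)) :
    -- (i) |log α| ≪ |log β|
    (Tendsto (fun x => |Real.log (α x)| / |Real.log (β x)|) F (𝓝 0) →
      (∀ i ∈ A, A ≠ Finset.univ →
        Tendsto (fun x => SeqMultTest.relEffSync P0 P1 l u i A (α x) (β x)) F (𝓝 0)) ∧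
      (∀ j ∉ A,
        Tendsto (fun x => SeqMultTest.relEffSync P0 P1 l u j A (α x) (β x)) F
          (𝓝 (SeqMultTest.noiseRate I u A (SeqMultTest.minOver J Aᶜ) /
            SeqMultTest.noiseRate I u A (ENNReal.ofReal (J j)))))) ∧
    -- (ii) |log α| ≫ |log β|
    (Tendsto (fun x => |Real.log (β x)| / |Real.log (α x)|) F (𝓝 0) →
      (∀ i ∈ A,
        Tendsto (fun x => SeqMultTest.relEffSync P0 P1 l u i A (α x) (β x)) F
          (𝓝 (SeqMultTest.signalRate J l A (SeqMultTest.minOver I A) /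
            SeqMultTest.signalRate J l A (ENNReal.ofReal (I i))))) ∧
      (∀ j ∉ A, A ≠ ∅ →
        Tendsto (fun x => SeqMultTest.relEffSync P0 P1 l u j A (α x) (β x)) F (𝓝 0))) ∧
    -- (iii) |log α| ∼ r |log β|
    (∀ r : ℝ, 0 < r →
      Tendsto (fun x => |Real.log (α x)| / (r * |Real.log (β x)|)) F (𝓝 1) →
      (∀ i ∈ A,
        Tendsto (fun x => SeqMultTest.relEffSync P0 P1 l u i A (α x) (β x)) F
          (𝓝 ((ENNReal.ofReal r / SeqMultTest.signalRate J l A (ENNReal.ofReal (I i))) /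
            max (ENNReal.ofReal r / SeqMultTest.signalRate J l A (SeqMultTest.minOver I A))
              (1 / SeqMultTest.noiseRate I u A (SeqMultTest.minOver J Aᶜ))))) ∧
      (∀ j ∉ A,
        Tendsto (fun x => SeqMultTest.relEffSync P0 P1 l u j A (α x) (β x)) F
          (𝓝 ((1 / SeqMultTest.noiseRate I u A (ENNReal.ofReal (J j))) /
            max (ENNReal.ofReal r / SeqMultTest.signalRate J l A (SeqMultTest.minOver I A))
              (1 / SeqMultTest.noiseRate I u A (SeqMultTest.minOver J Aᶜ)))))) := by 
  have hlog {γ : ι → ℝ} (hγ : Tendsto γ F (𝓝[>] 0)) :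
      Tendsto (fun x => -Real.log (γ x)) F atTop ∧ ∀ᶠ x in F, |Real.log (γ x)| = -Real.log (γ x) := by
    have h : Tendsto (fun x => -Real.log (γ x)) F atTop :=
      tendsto_neg_atBot_atTop.comp (Real.tendsto_log_nhdsGT_zero.comp hγ)
    refine ⟨h, ?_⟩
    filter_upwards [h.eventually_ge_atTop 0] with x hx
    exact abs_of_nonpos (by linarith)
  have hself {γ : ι → ℝ} (hγ : Tendsto γ F (𝓝[>] 0)) :
      Tendsto (fun x => -Real.log (γ x) / -Real.log (γ x)) F (𝓝 1) := by
    refine tendsto_const_nhds.congr' ?_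
    filter_upwards [(hlog hγ).1.eventually_gt_atTop 0] with x hx
    exact (div_self hx.ne').symm
  obtain ⟨hαtop, hαabs⟩ := hlog hα
  obtain ⟨hβtop, hβabs⟩ := hlog hβ
  refine ⟨fun h => ?_, fun h => ?_, fun r hr h => ?_⟩
  · have hp : Tendsto (fun x => -Real.log (α x) / -Real.log (β x)) F (𝓝 0) := by
      refine h.congr' ?_
      filter_upwards [hαabs, hβabs] with x hx hx'
      rw [hx, hx']
    -- Normalising by `|log β|` gives `p = 0` and `q = 1`; a noise stream is then needed for the
    -- synchronous limit to be nonzero.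
    have key := SeqMultTest.tendsto_relEffSync hI hJ hequiv hlim1 hlim0 hcomp1 hcomp0 huK hu hl hA
      hα hβ hβtop le_rfl zero_le_one hp (hself hβ)
    refine ⟨fun i hi hAne => ?_, fun j hj => ?_⟩
    · obtain ⟨j, hj⟩ : ∃ j, j ∉ A := by
        by_contra! hall
        exact hAne (Finset.eq_univ_iff_forall.2 hall)
      simpa [hi] using key ⟨j, by simp [hj]⟩ i
    · simpa [hj, SeqMultTest.streamRate, SeqMultTest.syncLimit,
        SeqMultTest.ennreal_inv_div_inv] using key ⟨j, by simp [hj]⟩ j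
  · have hq : Tendsto (fun x => -Real.log (β x) / -Real.log (α x)) F (𝓝 0) := by
      refine h.congr' ?_
      filter_upwards [hαabs, hβabs] with x hx hx'
      rw [hx, hx']
    -- Here the normalisation is `|log α|`, so `p = 1` and `q = 0`, and a signal stream plays that
    -- role.
    have key := SeqMultTest.tendsto_relEffSync hI hJ hequiv hlim1 hlim0 hcomp1 hcomp0 huK hu hl hA
      hα hβ hαtop zero_le_one le_rfl (hself hα) hq
    refine ⟨fun i hi => ?_, fun j hj hAne => ?_⟩
    · have := key ⟨i, by simp [hi]⟩ i
      simpa [hi, SeqMultTest.streamRate, SeqMultTest.syncLimit,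
        SeqMultTest.ennreal_inv_div_inv] using this
    · obtain ⟨i, hi⟩ := Finset.nonempty_iff_ne_empty.2 hAne
      simpa [hj] using key ⟨i, by simp [hi]⟩ j
  · have hp : Tendsto (fun x => -Real.log (α x) / -Real.log (β x)) F (𝓝 r) := by
      have h' := h.const_mul r
      rw [mul_one] at h'
      refine h'.congr' ?_
      filter_upwards [hαabs, hβabs, hβtop.eventually_gt_atTop 0] with x hx hx' hpos
      rw [hx, hx']
      field_simp
    -- Now `p = r` and `q = 1` are both positive, so any stream, such as `0`, makes the synchronous
    -- limit nonzero.
    have key := SeqMultTest.tendsto_relEffSync hI hJ hequiv hlim1 hlim0 hcomp1 hcomp0 huK hu hl hA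
      hα hβ hβtop hr.le zero_le_one hp (hself hβ) ⟨0, by split_ifs <;> linarith⟩
    refine ⟨fun i hi => ?_, fun j hj => ?_⟩
    · simpa [hi, SeqMultTest.streamRate, SeqMultTest.syncLimit] using key i
    · simpa [hj, SeqMultTest.streamRate, SeqMultTest.syncLimit] using key j
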